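/- Let $\alpha,\mu>-1$ and $\zeta<1$ be real and let $\omega\in\mathbb{C}$. For $t>0$ consider on $(0,\infty)$ the weight $$w(x)=w(x;t)=\bigl(1-\zeta\,\vartheta(x-t)\bigr)\,(x-t)^{\alpha}\,x^{\mu}e^{-x},$$ where $\vartheta(y)=1$ for $y>0$ and $\vartheta(y)=0$ otherwise, and where, for $x<t$, $(x-t)^\alpha$ stands for $\omega\,(t-x)^\alpha$, the constant $\omega$ being the value given to $(-1)^\alpha$ (so $\omega=1$ gives $|x-t|^\alpha$, $\omega=(-1)^\alpha$ gives the ordinary power if $\alpha$ is a non-negative integer, and $\omega=e^{i\pi\alpha}$ gives the principal branch). Put $\langle f,g\rangle_t=\int_0^\infty f(x)g(x)w(x;t)\,dx$. Let $n\ge 0$ be an integer, let $I\subseteq(0,\infty)$ be open, and suppose that for every $t\in I$ there are given polynomials $p_k(x)=p_k(x;t)=\gamma_kx^k+\gamma_{k,1}x^{k-1}+\dots+\gamma_{k,k}$ of degree exactly $k$, $0\le k\le n+1$, with $\langle p_i,p_j\rangle_t=\delta_{ij}$ for $0\le i,j\le n+1$. Let $a_0=0$, let $a_k=\gamma_{k-1}/\gamma_k$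 for $k\ge1$, and let $b_k=\gamma_{k,1}/\gamma_k-\gamma_{k+1,1}/\gamma_{k+1}$ (with $\gamma_{0,1}=0$) be the coefficients of the three-term recurrence $a_{k+1}p_{k+1}=(x-b_k)p_k-a_kp_{k-1}$, and define the functions of $t\in I$ $$\theta_n=b_n-2n-1-\alpha-\mu-t,\qquad \kappa_n=\Bigl(n+\frac{\mu}{2}\Bigr)t+a_n^2-\sum_{i=0}^{n-1}b_i .$$ Then $\theta_n$ and $\kappa_n$ are differentiable on $I$, and for all $t\in I$ $$t\,\theta_n'=2\kappa_n+(2n+\alpha+1+\mu+t+\theta_n)\,\theta_n ,$$ and, for all $t\in I$ with $\theta_n(t)\neq0$ and $\theta_n(t)+t\ne0$, $$t\,\kappa_n'=\Bigl(\frac1{\theta_n+t}+\frac1{\theta_n}\Bigr)\kappa_n^2+\Bigl(2n+\alpha+\mu+1-(2n+\alpha+\mu)\frac{t}{\theta_n+t}\Bigr)\kappa_n-\Bigl(n^2+\bigl(n+\tfrac{\mu}{2}\bigr)(\alpha+\mu)\Bigr)t-\frac{\mu^2t^2}{4\theta_n}+\Bigl(n+\frac{\mu}{2}\Bigr)\Bigl(n+\alpha+\frac{\mu}{2}\Bigr)\frac{t^2}{\theta_n+t}.$$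 -/

import Mathlib

open MeasureTheory

namespace DeformedLaguerre

noncomputable section

/-- The power `y ^ α` of a real number `y`, where for `y < 0` the symbol `y ^ α` means
`ω * (-y) ^ α`, the constant `ω` being the value that is given to `(-1) ^ α`. -/
def branchPow (ω : ℂ) (α y : ℝ) : ℂ :=
  if 0 ≤ y then ((y ^ α : ℝ) : ℂ) else ω * (((-y) ^ α : ℝ) : ℂ)

/-- With `ω = 1` the power is `|y| ^ α`. -/
theorem branchPow_one (α y : ℝ) : branchPow 1 α y = ((|y| ^ α : ℝ) : ℂ) := by
  unfold branchPow
  split_ifs with h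
  · rw [abs_of_nonneg h]
  · rw [abs_of_neg (not_le.mp h), one_mul]

/-- With `ω = (-1) ^ m` the power with the natural exponent `m` is the usual one. -/
theorem branchPow_natCast (m : ℕ) (y : ℝ) : branchPow ((-1) ^ m) m y = (y : ℂ) ^ m := by
  unfold branchPow
  split_ifs with h
  · simp
  · rw [Real.rpow_natCast]
    push_cast
    rw [← mul_pow]
    simp

/-- With `ω = exp (i π α)` the power is the principal complex power. -/
theorem branchPow_principal (α y : ℝ) :
    branchPow (Complex.exp (Real.pi * Complex.I * α)) α y = (y : ℂ) ^ (α : ℂ) := by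
  unfold branchPow
  split_ifs with h
  · exact Complex.ofReal_cpow h α
  · rw [Complex.ofReal_cpow_of_nonpos (not_le.mp h).le, Complex.ofReal_cpow (by linarith)]
    push_cast
    ring

/-- The Heaviside function: `1` for `y > 0` and `0` otherwise. -/
def heaviside (y : ℝ) : ℝ := if 0 < y then 1 else 0

/-- The weight `w(x) = (1 - ζ θ(x - t)) (x - t) ^ α x ^ μ exp (-x)`, `x > 0`. -/
def weight (α μ ζ : ℝ) (ω : ℂ) (t x : ℝ) : ℂ :=
  ((1 - ζ * heaviside (x - t) : ℝ) : ℂ) * branchPow ω α (x - t) *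
    ((x ^ μ * Real.exp (-x) : ℝ) : ℂ)

/-- The bilinear form `⟨f, g⟩ = ∫_0^∞ f(x) g(x) w(x) dx`. -/
def form (w : ℝ → ℂ) (f g : Polynomial ℂ) : ℂ :=
  ∫ x in Set.Ioi (0 : ℝ), f.eval (x : ℂ) * g.eval (x : ℂ) * w x

/-- `p 0, …, p N` are orthonormal polynomials for the weight `w`: `p k` has degree `k`,
and `⟨p i, p j⟩ = δ_{ij}`. -/
structure IsOrthonormalUpTo (w : ℝ → ℂ) (N : ℕ) (p : ℕ → Polynomial ℂ) : Prop where
  degree_eq : ∀ k ≤ N, (p k).degree = (k : WithBot ℕ)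
  orthonormal : ∀ i ≤ N, ∀ j ≤ N, form w (p i) (p j) = if i = j then 1 else 0

/-- The leading coefficient `γ_n` in `p_n(x) = γ_n x^n + γ_{n,1} x^{n-1} + …`. -/
def lead (p : ℕ → Polynomial ℂ) (n : ℕ) : ℂ := (p n).coeff n

/-- The second coefficient `γ_{n,1}` in `p_n(x) = γ_n x^n + γ_{n,1} x^{n-1} + …`,
with `γ_{0,1} = 0`. -/
def sublead (p : ℕ → Polynomial ℂ) : ℕ → ℂ
  | 0 => 0
  | n + 1 => (p (n + 1)).coeff n

/-- The recurrence coefficient `a_n = γ_{n-1} / γ_n`, with `a_0 = 0`. -/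
def recA (p : ℕ → Polynomial ℂ) : ℕ → ℂ
  | 0 => 0
  | n + 1 => lead p n / lead p (n + 1)

/-- The recurrence coefficient `b_n = γ_{n,1} / γ_n - γ_{n+1,1} / γ_{n+1}`. -/
def recB (p : ℕ → Polynomial ℂ) (n : ℕ) : ℂ :=
  sublead p n / lead p n - sublead p (n + 1) / lead p (n + 1)

/-- If `a_{k+1} p_{k+1} = (x - b_k) p_k - a_k p_{k-1}` for all `k < N`, where `a_0 = 0`
and `p_k` has degree `k`, then the coefficients `a_k` and `b_k` are `recA p k` and `recB p k`. -/
theorem recA_recB_of_recurrence {N : ℕ} {p : ℕ → Polynomial ℂ} {a b : ℕ → ℂ}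
    (hdeg : ∀ k ≤ N, (p k).degree = (k : WithBot ℕ)) (ha : a 0 = 0)
    (hrec : ∀ k < N, Polynomial.C (a (k + 1)) * p (k + 1) =
      (Polynomial.X - Polynomial.C (b k)) * p k - Polynomial.C (a k) * p (k - 1)) :
    (∀ k ≤ N, a k = recA p k) ∧ ∀ k < N, b k = recB p k := by
  have hlead : ∀ k ≤ N, lead p k ≠ 0 := fun k hk =>
    Polynomial.coeff_ne_zero_of_eq_degree (hdeg k hk)
  have hzero : ∀ k ≤ N, ∀ m, k < m → (p k).coeff m = 0 := fun k hk m hm =>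
    Polynomial.coeff_eq_zero_of_degree_lt (by rw [hdeg k hk]; exact_mod_cast hm)
  have key : ∀ k < N, a (k + 1) * lead p (k + 1) = lead p k := by
    intro k hk
    have h := congrArg (fun q => Polynomial.coeff q (k + 1)) (hrec k hk)
    simp only [sub_mul, Polynomial.coeff_sub, Polynomial.coeff_C_mul,
      Polynomial.coeff_X_mul] at h
    rw [hzero k hk.le (k + 1) (by omega), hzero (k - 1) (by omega) (k + 1) (by omega)] at h
    simpa [lead] using h
  have key2 : ∀ k < N, a (k + 1) * sublead p (k + 1) = sublead p k - b k * lead p k := by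
    intro k hk
    have h := congrArg (fun q => Polynomial.coeff q k) (hrec k hk)
    simp only [sub_mul, Polynomial.coeff_sub, Polynomial.coeff_C_mul] at h
    rcases k with _ | k
    · simpa [sublead, lead, ha] using h
    · rw [Polynomial.coeff_X_mul, Nat.add_sub_cancel,
        hzero k (by omega) (k + 1) (by omega)] at h
      simpa [sublead, lead] using h
  refine ⟨fun k hk => ?_, fun k hk => ?_⟩
  · rcases k with _ | k
    · exact ha
    · rw [recA, eq_div_iff (hlead _ hk)]
      exact key k hk
  · have h0 := hlead k hk.le
    have h1 := hlead (k + 1) hk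
    have e1 := key k hk
    have e2 := key2 k hk
    rw [recB, eq_sub_iff_add_eq, ← eq_sub_iff_add_eq', div_sub' h0, div_eq_div_iff h1 h0, ← e1]
    linear_combination lead p (k + 1) * e2 + b k * lead p (k + 1) * e1

/-- `θ_n = b_n - 2n - 1 - α - μ - t`. -/
def theta (α μ t : ℝ) (p : ℕ → Polynomial ℂ) (n : ℕ) : ℂ :=
  recB p n - 2 * n - 1 - α - μ - t

/-- `κ_n = (n + μ/2) t + a_n² - ∑_{i < n} b_i`. -/
def kappa (μ t : ℝ) (p : ℕ → Polynomial ℂ) (n : ℕ) : ℂ :=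
  (n + μ / 2) * t + recA p n ^ 2 - ∑ i ∈ Finset.range n, recB p i

/-- `κ_n = (n + μ/2) t + a_n² + γ_{n,1} / γ_n`. -/
theorem kappa_eq_sublead (μ t : ℝ) (p : ℕ → Polynomial ℂ) (n : ℕ) :
    kappa μ t p n = (n + μ / 2) * t + recA p n ^ 2 + sublead p n / lead p n := by
  have h : ∑ i ∈ Finset.range n, recB p i = - (sublead p n / lead p n) := by
    unfold recB
    rw [Finset.sum_range_sub' (fun i => sublead p i / lead p i)]
    simp [sublead]
  rw [kappa, h, sub_neg_eq_add]

end

end DeformedLaguerre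

open DeformedLaguerre

/-! ### Orthonormal polynomials of a linear functional and their three-term recurrence -/

namespace DeformedLaguerre

open Polynomial

/-! The substitution `x = t s` moves the singularity to the fixed point `s = 1`. The moments become
`t ^ (α + μ + k + 1)` times a combination, with coefficients `ω` and `1 - ζ`, of integrals over `(0,
1)` and `(1, ∞)` that are differentiable in `t` (`moment_eq`). Two facts about the moment functional
`L` follow. Integration by parts on each interval, without boundary terms, gives the Pearson
relation `IsPearson` with `W = x (x - t)`. Differentiation in `t` gives `t L'(f) = L(x f') + (α + μ
+ 1) L(f) - L(x f)`. The rest is algebra, in which `ω` and `ζ` play no role.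

Put `σ_n = γ_{n,1} / γ_n`. The Pearson relation yields the first Laguerre–Freud equation
`recA_sq_add_recA_sq`, and it expresses `W p_n'` and `W p_{n-1}'` through `p_n` and `p_{n-1}` with
polynomial coefficients. At `x = 0` and `x = t` the left sides vanish while `(p_n(x), p_{n-1}(x)) ≠
0`, so a determinant is zero (`det_eq_zero`). For `n ≥ 1` this says `a_n² θ_n θ_{n-1} = κ_n² - μ² t²
/ 4` and `a_n² (θ_n + t) (θ_{n-1} + t) = (κ_n - (n + (α + μ)/2) t)² - α² t² / 4`.

The derivative of `L` yields the Toda-type equations `t σ_n' = σ_n + a_n²` and `t (a_n²)' = (2 +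
b_{n-1} - b_n) a_n²`. Hence `t θ_n' = b_n + a_n² - a_{n+1}² - t`, where the Laguerre–Freud equation
removes `a_{n+1}²`. Likewise `t κ_n' = κ_n + a_n² (θ_{n-1} - θ_n)`, where the two determinant
identities supply `a_n² θ_{n-1}` and `a_n² θ_n`. -/

theorem map_C_mul (L : ℂ[X] →ₗ[ℂ] ℂ) (c : ℂ) (f : ℂ[X]) : L (C c * f) = c * L f := by
  rw [← smul_eq_C_mul, map_smul, smul_eq_mul]

theorem coeff_X_mul_derivative (f : ℂ[X]) (i : ℕ) :
    (X * derivative f).coeff i = i * f.coeff i := by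
  rcases i with _ | i
  · simp
  · rw [coeff_X_mul, coeff_derivative]
    push_cast
    ring

theorem X_mul_derivative_monomial (k : ℕ) (a : ℂ) :
    X * derivative (monomial k a) = monomial k (k * a) := by
  ext i
  rw [coeff_X_mul_derivative, coeff_monomial, coeff_monomial]
  split_ifs with h
  · rw [h]
  · simp

/-- `p 0, …, p N` have degrees `0, …, N` and are orthonormal for the bilinear form
`(f, g) ↦ L (f g)`. -/
structure IsOrthonormalFor (L : ℂ[X] →ₗ[ℂ] ℂ) (N : ℕ) (p : ℕ → ℂ[X]) : Prop where
  degree_eq : ∀ k ≤ N, (p k).degree = (k : WithBot ℕ)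
  orthonormal : ∀ i ≤ N, ∀ j ≤ N, L (p i * p j) = if i = j then 1 else 0

namespace IsOrthonormalFor

variable {L : ℂ[X] →ₗ[ℂ] ℂ} {N : ℕ} {p : ℕ → ℂ[X]}

theorem lead_ne_zero (h : IsOrthonormalFor L N p) {k : ℕ} (hk : k ≤ N) : lead p k ≠ 0 :=
  coeff_ne_zero_of_eq_degree (h.degree_eq k hk)

theorem coeff_eq_zero (h : IsOrthonormalFor L N p) {k : ℕ} (hk : k ≤ N) {i : ℕ} (hi : k < i) :
    (p k).coeff i = 0 :=
  coeff_eq_zero_of_degree_lt (by rw [h.degree_eq k hk]; exact_mod_cast hi)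

theorem coeff_sub_eq_zero (h : IsOrthonormalFor L N p) {m : ℕ} (hm : m ≤ N) {f : ℂ[X]}
    (hf : ∀ i, m < i → f.coeff i = 0) :
    ∀ i, m ≤ i → (f - C (f.coeff m / lead p m) * p m).coeff i = 0 := by
  intro i hi
  rw [coeff_sub, coeff_C_mul]
  rcases hi.eq_or_lt with rfl | hi
  · have := h.lead_ne_zero hm
    rw [← lead, div_mul_cancel₀ _ this, sub_self]
  · rw [hf i hi, h.coeff_eq_zero hm hi]
    simp

theorem map_mul_eq_zero (h : IsOrthonormalFor L N p) {k : ℕ} (hk : k ≤ N) :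
    ∀ m ≤ k, ∀ f : ℂ[X], (∀ i, m ≤ i → f.coeff i = 0) → L (f * p k) = 0 := by
  intro m
  induction m with
  | zero =>
    intro _ f hf
    have : f = 0 := by ext i; simpa using hf i (Nat.zero_le i)
    simp [this]
  | succ m ih =>
    intro hm f hf
    have h1 := ih (by omega) _ (h.coeff_sub_eq_zero (m := m) (by omega) (fun i hi => hf i hi))
    rw [sub_mul, map_sub, mul_assoc, map_C_mul, h.orthonormal m (by omega) k hk,
      if_neg (by omega)] at h1
    simpa using h1

theorem map_mul (h : IsOrthonormalFor L N p) {k : ℕ} (hk : k ≤ N) {f : ℂ[X]}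
    (hf : ∀ i, k < i → f.coeff i = 0) : L (f * p k) = f.coeff k / lead p k := by
  have h1 := h.map_mul_eq_zero hk k le_rfl _ (h.coeff_sub_eq_zero hk hf)
  rw [sub_mul, map_sub, mul_assoc, map_C_mul, h.orthonormal k hk k hk, if_pos rfl] at h1
  linear_combination h1

/-- Non-degeneracy of the form on polynomials of degree below `m`. The polynomial identities below
are proved with it: the top coefficients of the difference are compared directly, and the remainder
is tested against the few `p j` of lower degree, so no polynomial beyond `p N` is needed. -/
theorem eq_zero (h : IsOrthonormalFor L N p) : ∀ m ≤ N + 1, ∀ f : ℂ[X],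
    (∀ i, m ≤ i → f.coeff i = 0) → (∀ j < m, L (f * p j) = 0) → f = 0 := by
  intro m
  induction m with
  | zero =>
    intro _ f hf _
    ext i
    simpa using hf i (Nat.zero_le i)
  | succ m ih =>
    intro hm f hf hj
    have h1 := ih (by omega) _ (h.coeff_sub_eq_zero (m := m) (by omega) (fun i hi => hf i hi))
      (fun j hjm => by
        rw [sub_mul, map_sub, mul_assoc, map_C_mul, h.orthonormal m (by omega) j (by omega),
          if_neg (by omega), hj j (by omega)]
        simp)
    have h2 := h.map_mul (k := m) (by omega) (fun i hi => hf i hi)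
    rw [hj m (by omega)] at h2
    rw [← h2] at h1
    simpa using h1

theorem map_X_mul_mul_succ (h : IsOrthonormalFor L N p) {k : ℕ} (hk : k + 1 ≤ N) :
    L (X * p k * p (k + 1)) = recA p (k + 1) := by
  rw [h.map_mul hk, coeff_X_mul]
  · rfl
  intro i hi
  obtain ⟨i, rfl⟩ : ∃ j, i = j + 1 := ⟨i - 1, by omega⟩
  rw [coeff_X_mul, h.coeff_eq_zero (by omega) (by omega)]

theorem map_X_mul_mul_eq_zero (h : IsOrthonormalFor L N p) {j k : ℕ} (hk : k ≤ N)
    (hjk : j + 1 < k) : L (X * p j * p k) = 0 := by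
  refine h.map_mul_eq_zero hk k le_rfl _ fun i hi => ?_
  obtain ⟨i, rfl⟩ : ∃ j, i = j + 1 := ⟨i - 1, by omega⟩
  rw [coeff_X_mul, h.coeff_eq_zero (by omega) (by omega)]

theorem recA_ne_zero (h : IsOrthonormalFor L N p) {k : ℕ} (hk : k + 1 ≤ N) :
    recA p (k + 1) ≠ 0 :=
  div_ne_zero (h.lead_ne_zero (by omega)) (h.lead_ne_zero hk)

/-- The three-term recurrence. -/
theorem recurrence (h : IsOrthonormalFor L N p) {k : ℕ} (hk : k + 1 ≤ N) :
    X * p k = C (recA p (k + 1)) * p (k + 1) + C (recB p k) * p k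
      + C (recA p k) * p (k - 1) := by
  have h0 := h.lead_ne_zero (k := k) (by omega)
  have h1 := h.lead_ne_zero hk
  have key : X * p k - C (recA p (k + 1)) * p (k + 1) - C (recB p k) * p k
      - C (recA p k) * p (k - 1) = 0 := by
    refine h.eq_zero k (by omega) _ (fun i hi => ?_) (fun j hj => ?_)
    · simp only [coeff_sub, coeff_C_mul]
      -- For `k = 0` the index `k - 1` is again `0`, but the term is killed by `recA p 0 = 0`.
      have h3 : recA p k * (p (k - 1)).coeff i = 0 := by
        rcases k with _ | k
        · simp [recA]
        · rw [h.coeff_eq_zero (by omega) (by omega), mul_zero]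
      rw [h3]
      rcases hi.eq_or_lt with rfl | hi
      · have h4 : (X * p k).coeff k = sublead p k := by
          rcases k with _ | k
          · simp [sublead]
          · rw [coeff_X_mul, sublead]
        have h5 : (p (k + 1)).coeff k = sublead p (k + 1) := rfl
        have h6 : (p k).coeff k = lead p k := rfl
        rw [h4, h5, h6, recA, recB]
        field_simp
        ring
      · obtain ⟨i, rfl⟩ : ∃ j, i = j + 1 := ⟨i - 1, by omega⟩
        rw [coeff_X_mul, h.coeff_eq_zero (k := k) (i := i + 1) (by omega) (by omega)]
        rcases (show k ≤ i by omega).eq_or_lt with rfl | hi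
        · simp only [recA, lead] at h0 h1 ⊢
          field_simp
          ring
        · rw [h.coeff_eq_zero (k := k) (i := i) (by omega) (by omega),
            h.coeff_eq_zero (k := k + 1) (i := i + 1) (by omega) (by omega)]
          simp
    · obtain ⟨k, rfl⟩ : ∃ l, k = l + 1 := ⟨k - 1, by omega⟩
      simp only [sub_mul, map_sub, mul_assoc, map_C_mul, Nat.add_sub_cancel]
      rw [h.orthonormal (k + 1 + 1) (by omega) j (by omega), if_neg (by omega),
        h.orthonormal (k + 1) (by omega) j (by omega), if_neg (by omega),
        h.orthonormal k (by omega) j (by omega),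
        show X * (p (k + 1) * p j) = X * p j * p (k + 1) by ring]
      rcases (show j ≤ k by omega).eq_or_lt with rfl | hj
      · rw [h.map_X_mul_mul_succ (by omega), if_pos rfl]
        simp
      · rw [h.map_X_mul_mul_eq_zero (by omega) (by omega), if_neg (by omega)]
        simp
  linear_combination key

theorem map_X_mul_mul_self (h : IsOrthonormalFor L N p) {k : ℕ} (hk : k + 1 ≤ N) :
    L (X * p k * p k) = recB p k := by
  rw [h.recurrence hk]
  simp only [add_mul, map_add, mul_assoc, map_C_mul]
  rw [h.orthonormal (k + 1) (by omega) k (by omega), if_neg (by omega),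
    h.orthonormal k (by omega) k (by omega), if_pos rfl]
  rcases k with _ | k
  · simp [recA]
  · rw [h.orthonormal _ (by omega) _ (by omega), if_neg (by omega)]
    simp

theorem map_X_sq_mul_self (h : IsOrthonormalFor L N p) {k : ℕ} (hk : k + 1 ≤ N) :
    L (X * (X * p k) * p k) = recA p (k + 1) ^ 2 + recB p k ^ 2 + recA p k ^ 2 := by
  have e : X * (X * p k) * p k = C (recA p (k + 1)) * (X * p k * p (k + 1))
      + C (recB p k) * (X * p k * p k) + C (recA p k) * (X * p (k - 1) * p k) := by
    linear_combination X * p k * h.recurrence hk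
  rw [e]
  simp only [map_add, map_C_mul]
  rw [h.map_X_mul_mul_succ hk, h.map_X_mul_mul_self hk]
  rcases k with _ | k
  · simp [recA]
    ring
  · rw [Nat.add_sub_cancel, h.map_X_mul_mul_succ (by omega)]
    ring

theorem map_X_sq_mul_succ (h : IsOrthonormalFor L N p) {k : ℕ} (hk : k + 2 ≤ N) :
    L (X * (X * p k) * p (k + 1)) = recA p (k + 1) * (recB p (k + 1) + recB p k) := by
  have e : X * (X * p k) * p (k + 1) = C (recA p (k + 1)) * (X * p (k + 1) * p (k + 1))
      + C (recB p k) * (X * p k * p (k + 1)) + C (recA p k) * (X * p (k - 1) * p (k + 1)) := by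
    linear_combination X * p (k + 1) * h.recurrence (k := k) (by omega)
  rw [e]
  simp only [map_add, map_C_mul]
  rw [h.map_X_mul_mul_succ (by omega), h.map_X_mul_mul_self (by omega)]
  rcases k with _ | k
  · simp [recA]
    ring
  · rw [Nat.add_sub_cancel, h.map_X_mul_mul_eq_zero (by omega) (by omega)]
    ring

theorem map_X_sq_mul_add_two (h : IsOrthonormalFor L N p) {k : ℕ} (hk : k + 2 ≤ N) :
    L (X * (X * p k) * p (k + 2)) = recA p (k + 1) * recA p (k + 2) := by
  have e : X * (X * p k) * p (k + 2) = C (recA p (k + 1)) * (X * p (k + 1) * p (k + 2))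
      + C (recB p k) * (X * p k * p (k + 2)) + C (recA p k) * (X * p (k - 1) * p (k + 2)) := by
    linear_combination X * p (k + 2) * h.recurrence (k := k) (by omega)
  rw [e]
  simp only [map_add, map_C_mul]
  rw [h.map_X_mul_mul_succ (by omega), h.map_X_mul_mul_eq_zero (by omega) (by omega)]
  rcases k with _ | k
  · simp [recA]
  · rw [Nat.add_sub_cancel, h.map_X_mul_mul_eq_zero (by omega) (by omega)]
    ring

theorem map_X_sq_mul_eq_zero (h : IsOrthonormalFor L N p) {j k : ℕ} (hk : k ≤ N)
    (hjk : j + 2 < k) : L (X * (X * p j) * p k) = 0 := by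
  refine h.map_mul_eq_zero hk k le_rfl _ fun i hi => ?_
  obtain ⟨i, rfl⟩ : ∃ j, i = j + 2 := ⟨i - 2, by omega⟩
  rw [coeff_X_mul, coeff_X_mul, h.coeff_eq_zero (by omega) (by omega)]

theorem map_X_derivative_mul_self (h : IsOrthonormalFor L N p) {k : ℕ} (hk : k ≤ N) :
    L (X * derivative (p k) * p k) = k := by
  rw [h.map_mul hk, coeff_X_mul_derivative]
  · exact mul_div_cancel_right₀ _ (h.lead_ne_zero hk)
  · intro i hi
    rw [coeff_X_mul_derivative, h.coeff_eq_zero hk hi, mul_zero]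

theorem map_X_derivative_mul_eq_zero (h : IsOrthonormalFor L N p) {j k : ℕ} (hk : k ≤ N)
    (hj : j < k) : L (X * derivative (p j) * p k) = 0 := by
  refine h.map_mul_eq_zero hk k le_rfl _ fun i hi => ?_
  rw [coeff_X_mul_derivative, h.coeff_eq_zero (by omega) (by omega), mul_zero]

theorem map_X_sq_derivative_mul_succ (h : IsOrthonormalFor L N p) {k : ℕ} (hk : k + 1 ≤ N) :
    L (X * (X * derivative (p k)) * p (k + 1)) = k * recA p (k + 1) := by
  rw [h.map_mul hk, coeff_X_mul, coeff_X_mul_derivative, recA, mul_div_assoc]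
  · rfl
  intro i hi
  obtain ⟨i, rfl⟩ : ∃ j, i = j + 1 := ⟨i - 1, by omega⟩
  rw [coeff_X_mul, coeff_X_mul_derivative, h.coeff_eq_zero (by omega) (by omega), mul_zero]

theorem map_X_sq_derivative_mul_eq_zero (h : IsOrthonormalFor L N p) {j k : ℕ} (hk : k ≤ N)
    (hj : j + 1 < k) : L (X * (X * derivative (p j)) * p k) = 0 := by
  refine h.map_mul_eq_zero hk k le_rfl _ fun i hi => ?_
  obtain ⟨i, rfl⟩ : ∃ j, i = j + 1 := ⟨i - 1, by omega⟩
  rw [coeff_X_mul, coeff_X_mul_derivative, h.coeff_eq_zero (by omega) (by omega), mul_zero]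

/-- In `x² p_k' - k x p_k` the terms of degree `k + 1` cancel, and the coefficient of `x ^ k` is
`-γ_{k,1}`. -/
theorem map_X_sq_derivative_mul_self (h : IsOrthonormalFor L N p) {k : ℕ} (hk : k + 1 ≤ N) :
    L (X * (X * derivative (p k)) * p k) = k * recB p k - sublead p k / lead p k := by
  have e : X * (X * derivative (p k)) * p k = C (k : ℂ) * (X * p k * p k)
      + (X * (X * derivative (p k)) - C (k : ℂ) * (X * p k)) * p k := by ring
  rw [e, map_add, map_C_mul, h.map_X_mul_mul_self hk, h.map_mul (by omega), coeff_sub,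
    coeff_C_mul]
  · rcases k with _ | k
    · simp [sublead]
    · rw [coeff_X_mul, coeff_X_mul, coeff_X_mul_derivative, sublead]
      push_cast
      ring
  · intro i hi
    obtain ⟨i, rfl⟩ : ∃ j, i = j + 1 := ⟨i - 1, by omega⟩
    rw [coeff_sub, coeff_C_mul, coeff_X_mul, coeff_X_mul, coeff_X_mul_derivative]
    rcases (show k ≤ i by omega).eq_or_lt with rfl | hi
    · ring
    · rw [h.coeff_eq_zero (by omega) hi]
      ring

/-- Read downwards, the recurrence carries a common zero of two consecutive polynomials to the pair
below, as `a_k ≠ 0`, and finally to the non-zero constant `p 0`. -/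
theorem eval_ne_zero_or (h : IsOrthonormalFor L N p) (x : ℂ) :
    ∀ k, k + 1 ≤ N → (p (k + 1)).eval x ≠ 0 ∨ (p k).eval x ≠ 0 := by
  intro k
  induction k with
  | zero =>
    intro hk
    right
    have h0 := h.lead_ne_zero (k := 0) (by omega)
    rw [eq_C_of_degree_le_zero (p := p 0) (by rw [h.degree_eq 0 (by omega)]; rfl), eval_C]
    exact h0
  | succ k ih =>
    intro hk
    by_contra! hc
    have h1 := congrArg (eval x) (h.recurrence hk)
    simp only [eval_mul, eval_add, eval_X, eval_C, hc.1, hc.2, Nat.add_sub_cancel] at h1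
    have h2 := h.recA_ne_zero (k := k) (by omega)
    rcases ih (by omega) with h3 | h3
    · exact h3 hc.2
    · exact mul_ne_zero h2 h3 (by linear_combination -h1)

end IsOrthonormalFor

end DeformedLaguerre

/-! ### Pearson relation, structure relations and their compatibility -/

namespace DeformedLaguerre

open Polynomial

/-- The Pearson relation `(W w)' = (-x² + (α + μ + 2 + t) x - (μ + 1) t) w`, `W = x (x - t)`,
for the functional `L` of the weight `w`. -/
def IsPearson (L : ℂ[X] →ₗ[ℂ] ℂ) (α μ t : ℂ) : Prop :=
  ∀ f : ℂ[X], L (X * (X * derivative f)) - t * L (X * derivative f) - L (X * (X * f))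
    + (α + μ + 2 + t) * L (X * f) - (μ + 1) * t * L f = 0

variable {L : ℂ[X] →ₗ[ℂ] ℂ} {N : ℕ} {p : ℕ → ℂ[X]} {α μ t : ℂ}

theorem IsPearson.mul (hL : IsPearson L α μ t) (f g : ℂ[X]) :
    L (X * (X * derivative f) * g) - t * L (X * derivative f * g)
      + L (X * (X * derivative g) * f) - t * L (X * derivative g * f)
      - L (X * (X * f) * g) + (α + μ + 2 + t) * L (X * f * g) - (μ + 1) * t * L (f * g) = 0 := by
  have h := hL (f * g)
  rw [derivative_mul,
    show X * (X * (derivative f * g + f * derivative g))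
      = X * (X * derivative f) * g + X * (X * derivative g) * f by ring,
    show X * (derivative f * g + f * derivative g)
      = X * derivative f * g + X * derivative g * f by ring,
    show X * (X * (f * g)) = X * (X * f) * g by ring,
    show X * (f * g) = X * f * g by ring, map_add, map_add] at h
  linear_combination h

namespace IsOrthonormalFor

/-- The first Laguerre–Freud equation. -/
theorem recA_sq_add_recA_sq (h : IsOrthonormalFor L N p) (hL : IsPearson L α μ t) {n : ℕ}
    (hn : n + 1 ≤ N) :
    recA p (n + 1) ^ 2 + recB p n ^ 2 + recA p n ^ 2 = 2 * n * recB p n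
      - 2 * (sublead p n / lead p n) - 2 * n * t + (α + μ + 2 + t) * recB p n - (μ + 1) * t := by
  have e := hL.mul (p n) (p n)
  rw [h.map_X_sq_derivative_mul_self hn, h.map_X_derivative_mul_self (by omega),
    h.map_X_sq_mul_self hn, h.map_X_mul_mul_self hn, h.orthonormal n (by omega) n (by omega),
    if_pos rfl] at e
  linear_combination -e

/-- The structure relation for `p_{m+1}`. -/
theorem structure_succ (h : IsOrthonormalFor L N p) (hL : IsPearson L α μ t) {m : ℕ}
    (hm : m + 2 ≤ N) :
    X * (X * derivative (p (m + 1))) - C t * (X * derivative (p (m + 1))) =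
      C ((m : ℂ) + 1) * (X * p (m + 1))
      - C (sublead p (m + 1) / lead p (m + 1) + (m + 1) * t + recA p (m + 1) ^ 2) * p (m + 1)
      - C (recA p (m + 1)) * (C (2 * (m + 1) + 1 + α + μ + t - recB p (m + 1)) * p m
        - X * p m) := by
  -- The term `X * p m` absorbs the component along `p_{m-1}`, so that only `p_{m+1}` and `p_m`
  -- enter. By the Pearson relation the derivative passes from `p_{m+1}` to `p j`; only `j = m` and
  -- `j = m - 1` give non-trivial terms.
  have key : X * (X * derivative (p (m + 1))) - C t * (X * derivative (p (m + 1)))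
      - C ((m : ℂ) + 1) * (X * p (m + 1))
      + C (sublead p (m + 1) / lead p (m + 1) + (m + 1) * t + recA p (m + 1) ^ 2) * p (m + 1)
      + C (recA p (m + 1)) * (C (2 * (m + 1) + 1 + α + μ + t - recB p (m + 1)) * p m
        - X * p m) = 0 := by
    refine h.eq_zero (m + 1) (by omega) _ (fun i hi => ?_) (fun j hj => ?_)
    · obtain ⟨i, rfl⟩ : ∃ j, i = j + 1 := ⟨i - 1, by omega⟩
      simp only [coeff_sub, coeff_add, coeff_C_mul, coeff_X_mul, coeff_X_mul_derivative,
        coeff_derivative]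
      rw [h.coeff_eq_zero (k := m) (i := i + 1) (by omega) (by omega)]
      rcases (show m ≤ i by omega).eq_or_lt with rfl | hi
      · have h1 : (p (m + 1)).coeff m = sublead p (m + 1) := rfl
        have h2 : (p (m + 1)).coeff (m + 1) = lead p (m + 1) := rfl
        have h3 : (p m).coeff m = lead p m := rfl
        have h4 := h.lead_ne_zero (k := m + 1) (by omega)
        rw [h1, h2, h3, recA]
        field_simp
        ring
      · rw [h.coeff_eq_zero (k := m + 1) (i := i + 1) (by omega) (by omega),
          h.coeff_eq_zero (k := m) (i := i) (by omega) (by omega)]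
        rcases (show m + 1 ≤ i by omega).eq_or_lt with rfl | hi
        · push_cast
          ring
        · rw [h.coeff_eq_zero (k := m + 1) (i := i) (by omega) (by omega)]
          ring
    · simp only [add_mul, sub_mul, map_add, map_sub, mul_assoc, map_C_mul]
      simp only [← mul_assoc]
      have e := hL.mul (p (m + 1)) (p j)
      rw [mul_assoc X (p (m + 1)), mul_comm (p (m + 1)) (p j), ← mul_assoc X (p j)]
      rw [mul_comm (p (m + 1)) (p j), mul_assoc X (X * p (m + 1)), mul_assoc X (p (m + 1)),
        mul_comm (p (m + 1)) (p j), ← mul_assoc X (p j), ← mul_assoc X (X * p j)] at e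
      simp only [← mul_assoc] at e
      have f1 := h.orthonormal j (by omega) (m + 1) (by omega)
      have f2 := h.map_X_derivative_mul_eq_zero (j := j) (k := m + 1) (by omega) (by omega)
      rw [if_neg (by omega)] at f1
      rw [f1, f2] at e
      rw [f1]
      have f3 := h.orthonormal m (by omega) j (by omega)
      rw [f3]
      rcases (show j ≤ m by omega).eq_or_lt with rfl | hj
      · have g1 := h.map_X_mul_mul_succ (k := j) (by omega)
        have g2 := h.map_X_sq_derivative_mul_succ (k := j) (by omega)
        have g3 := h.map_X_sq_mul_succ (k := j) (by omega)
        have g4 := h.map_X_mul_mul_self (k := j) (by omega)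
        simp only [← mul_assoc] at g2 g3
        rw [g1, g2, g3] at e
        rw [g1, g4, if_pos rfl]
        linear_combination e
      · obtain ⟨m, rfl⟩ : ∃ l, m = l + 1 := ⟨m - 1, by omega⟩
        have g1 := h.map_X_mul_mul_eq_zero (j := j) (k := m + 1 + 1) (by omega) (by omega)
        have g2 := h.map_X_sq_derivative_mul_eq_zero (j := j) (k := m + 1 + 1) (by omega)
          (by omega)
        simp only [← mul_assoc] at g2
        rw [g1, g2] at e
        rw [g1, if_neg (by omega), mul_assoc X (p (m + 1)), mul_comm (p (m + 1)) (p j),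
          ← mul_assoc X (p j)]
        rcases (show j ≤ m by omega).eq_or_lt with rfl | hj
        · have g3 := h.map_X_mul_mul_succ (k := j) (by omega)
          have g4 := h.map_X_sq_mul_add_two (k := j) (by omega)
          simp only [← mul_assoc] at g4
          rw [g4] at e
          rw [g3]
          linear_combination e
        · have g3 := h.map_X_mul_mul_eq_zero (j := j) (k := m + 1) (by omega) (by omega)
          have g4 := h.map_X_sq_mul_eq_zero (j := j) (k := m + 1 + 1) (by omega) (by omega)
          simp only [← mul_assoc] at g4
          rw [g4] at e
          rw [g3]
          linear_combination e
  linear_combination key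

/-- The structure relation for `p_m` in terms of `p_{m+1}`. -/
theorem structure_pred (h : IsOrthonormalFor L N p) (hL : IsPearson L α μ t) {m : ℕ}
    (hm : m + 2 ≤ N) :
    X * (X * derivative (p m)) - C t * (X * derivative (p m)) =
      X * (X * p m) - C (α + μ + t + (m + 1)) * (X * p m)
      + C (μ * t + (sublead p (m + 1) / lead p (m + 1) + (m + 1) * t + recA p (m + 1) ^ 2)) * p m
      + C (recA p (m + 1)) * (C (2 * m + 1 + α + μ + t - recB p m) * p (m + 1)
        - X * p (m + 1)) := by
  have key : X * (X * derivative (p m)) - C t * (X * derivative (p m))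
      - X * (X * p m) + C (α + μ + t + (m + 1)) * (X * p m)
      - C (μ * t + (sublead p (m + 1) / lead p (m + 1) + (m + 1) * t + recA p (m + 1) ^ 2)) * p m
      - C (recA p (m + 1)) * (C (2 * m + 1 + α + μ + t - recB p m) * p (m + 1)
        - X * p (m + 1)) = 0 := by
    refine h.eq_zero (m + 2) (by omega) _ (fun i hi => ?_) (fun j hj => ?_)
    · obtain ⟨i, rfl⟩ : ∃ j, i = j + 1 + 1 := ⟨i - 2, by omega⟩
      simp only [coeff_sub, coeff_add, coeff_C_mul, coeff_X_mul, coeff_derivative]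
      rw [h.coeff_eq_zero (k := m) (i := i + 1) (by omega) (by omega),
        h.coeff_eq_zero (k := m) (i := i + 1 + 1) (by omega) (by omega),
        h.coeff_eq_zero (k := m + 1) (i := i + 1 + 1) (by omega) (by omega)]
      rcases (show m ≤ i by omega).eq_or_lt with rfl | hi
      · have h2 : (p (m + 1)).coeff (m + 1) = lead p (m + 1) := rfl
        have h3 : (p m).coeff m = lead p m := rfl
        have h4 := h.lead_ne_zero (k := m + 1) (by omega)
        rw [h2, h3, recA]
        field_simp
        ring
      · rw [h.coeff_eq_zero (k := m + 1) (i := i + 1) (by omega) (by omega),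
          h.coeff_eq_zero (k := m) (i := i) (by omega) (by omega)]
        ring
    · simp only [add_mul, sub_mul, map_add, map_sub, mul_assoc, map_C_mul]
      simp only [← mul_assoc]
      have e := hL.mul (p m) (p j)
      rw [mul_assoc X (X * p m)] at e
      simp only [← mul_assoc] at e
      have sub := h.recA_sq_add_recA_sq hL (n := m) (by omega)
      have f1 := h.orthonormal m (by omega) j (by omega)
      have f2 := h.orthonormal (m + 1) (by omega) j (by omega)
      rw [f1, f2]
      rw [f1] at e
      rcases (show j ≤ m + 1 by omega).eq_or_lt with rfl | hj
      · have g1 := h.map_X_mul_mul_self (k := m + 1) (by omega)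
        -- The Pearson relation links `L(W p_m' p_{m+1})` with `L(W p_{m+1}' p_m)`, and the latter
        -- is known from `structure_succ`.
        have g2 := congrArg (fun q => L (q * p m)) (h.structure_succ hL hm)
        simp only [add_mul, sub_mul, map_add, map_sub, mul_assoc, map_C_mul] at g2
        simp only [← mul_assoc] at g2
        have g3 := h.map_X_mul_mul_succ (k := m) (by omega)
        have g4 := h.map_X_mul_mul_self (k := m) (by omega)
        have g5 := h.orthonormal m (by omega) m (by omega)
        have g6 := h.orthonormal (m + 1) (by omega) m (by omega)
        rw [mul_assoc X (p (m + 1)) (p m), mul_comm (p (m + 1)) (p m), ← mul_assoc X, g3, g4,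
          mul_comm (p m) (p (m + 1)), g6, g5, if_pos rfl, if_neg (by omega)] at g2
        rw [if_neg (by omega)] at e
        rw [g1, g3, if_neg (by omega), if_pos rfl]
        rw [g3] at e
        linear_combination e - g2
      · rw [if_neg (show ¬ m + 1 = j by omega), mul_assoc X (p (m + 1)),
          mul_comm (p (m + 1)) (p j), ← mul_assoc X (p j)]
        rcases (show j ≤ m by omega).eq_or_lt with rfl | hj
        · have g1 := h.map_X_mul_mul_succ (k := j) (by omega)
          have g2 := h.map_X_sq_derivative_mul_self (k := j) (by omega)
          have g3 := h.map_X_derivative_mul_self (k := j) (by omega)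
          have g4 := h.map_X_mul_mul_self (k := j) (by omega)
          have g5 : recB p j = sublead p j / lead p j - sublead p (j + 1) / lead p (j + 1) := rfl
          simp only [← mul_assoc] at g2
          rw [g2, g3, g4, if_pos rfl] at e
          rw [g1, g2, g3, g4, if_pos rfl]
          linear_combination e - g5
        · have f3 := h.map_X_mul_mul_eq_zero (j := j) (k := m + 1) (by omega) (by omega)
          have f4 := h.map_X_derivative_mul_eq_zero (j := j) (k := m) (by omega) (by omega)
          rw [if_neg (by omega), mul_assoc X (p m), mul_comm (p m) (p j), ← mul_assoc X (p j),
            f4] at e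
          rw [if_neg (by omega), f3, mul_assoc X (p m), mul_comm (p m) (p j),
            ← mul_assoc X (p j)]
          obtain ⟨m, rfl⟩ : ∃ l, m = l + 1 := ⟨m - 1, by omega⟩
          rcases (show j ≤ m by omega).eq_or_lt with rfl | hj
          · have g1 := h.map_X_mul_mul_succ (k := j) (by omega)
            have g2 := h.map_X_sq_derivative_mul_succ (k := j) (by omega)
            simp only [← mul_assoc] at g2
            rw [g1, g2] at e
            rw [g1]
            push_cast
            linear_combination e
          · have g1 := h.map_X_mul_mul_eq_zero (j := j) (k := m + 1) (by omega) (by omega)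
            have g2 := h.map_X_sq_derivative_mul_eq_zero (j := j) (k := m + 1) (by omega)
              (by omega)
            simp only [← mul_assoc] at g2
            rw [g1, g2] at e
            rw [g1]
            push_cast
            linear_combination e
  linear_combination key

/-- The compatibility of the two structure relations at a zero `x` of `W`. -/
theorem det_eq_zero (h : IsOrthonormalFor L N p) (hL : IsPearson L α μ t) {m : ℕ}
    (hm : m + 2 ≤ N) {x : ℂ} (hx : x * (x - t) = 0) :
    recA p (m + 1) ^ 2 * (2 * (m + 1) + 1 + α + μ + t - recB p (m + 1) - x)
        * (2 * m + 1 + α + μ + t - recB p m - x) =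
      ((m + 1) * x - (sublead p (m + 1) / lead p (m + 1) + (m + 1) * t + recA p (m + 1) ^ 2))
      * ((m + 1) * x - (sublead p (m + 1) / lead p (m + 1) + (m + 1) * t + recA p (m + 1) ^ 2)
        - x ^ 2 + (α + μ + t) * x - μ * t) := by
  have e1 := congrArg (eval x) (h.structure_succ hL hm)
  have e2 := congrArg (eval x) (h.structure_pred hL hm)
  simp only [eval_sub, eval_add, eval_mul, eval_X, eval_C] at e1 e2
  generalize sublead p (m + 1) / lead p (m + 1) + (m + 1) * t + recA p (m + 1) ^ 2 = c at *
  -- As `W(x) = 0`, `e1` and `e2` are two homogeneous linear equations for `(p_{m+1}(x), p_m(x))`.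
  -- Eliminating either entry leaves the determinant times the other one, which may be taken
  -- non-zero.
  rcases h.eval_ne_zero_or x m (by omega) with h0 | h0
  · refine mul_right_cancel₀ h0 ?_
    linear_combination
      ((m + 1) * x - c - x ^ 2 + (α + μ + t) * x - μ * t) * e1
      + (-recA p (m + 1) * (2 * (m + 1) + 1 + α + μ + t - recB p (m + 1) - x)) * e2
      + (-((m + 1) * x - c - x ^ 2 + (α + μ + t) * x - μ * t) * eval x (derivative (p (m + 1)))
        + recA p (m + 1) * (2 * (m + 1) + 1 + α + μ + t - recB p (m + 1) - x)
          * eval x (derivative (p m))) * hx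
  · refine mul_right_cancel₀ h0 ?_
    linear_combination
      (recA p (m + 1) * (2 * m + 1 + α + μ + t - recB p m - x)) * e1
      + (-((m + 1) * x - c)) * e2
      + (-recA p (m + 1) * (2 * m + 1 + α + μ + t - recB p m - x)
          * eval x (derivative (p (m + 1)))
        + ((m + 1) * x - c) * eval x (derivative (p m))) * hx

end IsOrthonormalFor

end DeformedLaguerre

/-! ### Polynomials and moment functionals depending on a parameter -/

namespace DeformedLaguerre

open Polynomial Filter Topology

/-- The linear functional on polynomials with the moments `m 0, m 1, …`. -/
noncomputable def momentFunctional (m : ℕ → ℂ) : ℂ[X] →ₗ[ℂ] ℂ :=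
  lsum fun k => m k • LinearMap.id

theorem momentFunctional_monomial (m : ℕ → ℂ) (k : ℕ) (c : ℂ) :
    momentFunctional m (monomial k c) = c * m k := by
  simp [momentFunctional, mul_comm]

theorem momentFunctional_eq_sum (m : ℕ → ℂ) {f : ℂ[X]} {N : ℕ}
    (hf : ∀ i, N ≤ i → f.coeff i = 0) :
    momentFunctional m f = ∑ i ∈ Finset.range N, f.coeff i * m i := by
  have : f = ∑ i ∈ Finset.range N, monomial i (f.coeff i) := by
    ext j
    simp only [finsetSum_coeff, coeff_monomial, Finset.sum_ite_eq', Finset.mem_range]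
    split_ifs with h
    · rfl
    · exact hf j (not_lt.mp h)
  conv_lhs => rw [this]
  simp [momentFunctional_monomial]

/-- The polynomials `P s` have bounded degree for `s` near `t`, and the coefficients of `P'`
are the derivatives at `t` of the coefficients. -/
def HasCoeffDerivAt (P : ℝ → ℂ[X]) (P' : ℂ[X]) (t : ℝ) : Prop :=
  (∃ N, ∀ᶠ s in 𝓝 t, ∀ i, N ≤ i → (P s).coeff i = 0) ∧
    ∀ i, HasDerivAt (fun s => (P s).coeff i) (P'.coeff i) t

namespace HasCoeffDerivAt

variable {P Q : ℝ → ℂ[X]} {P' Q' : ℂ[X]} {t : ℝ}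

theorem congr (hP : HasCoeffDerivAt P P' t) (h : Q =ᶠ[𝓝 t] P) : HasCoeffDerivAt Q P' t := by
  obtain ⟨⟨N, hN⟩, hd⟩ := hP
  refine ⟨⟨N, ?_⟩, fun i => (hd i).congr_of_eventuallyEq ?_⟩
  · filter_upwards [hN, h] with s h1 h2
    rwa [h2]
  · filter_upwards [h] with s h2
    rw [h2]

theorem coeff_eq_zero (hP : HasCoeffDerivAt P P' t) {i : ℕ} {c : ℂ}
    (h : ∀ᶠ s in 𝓝 t, (P s).coeff i = c) : P'.coeff i = 0 :=
  (hP.2 i).unique ((hasDerivAt_const t c).congr_of_eventuallyEq h)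

theorem const (f : ℂ[X]) (t : ℝ) : HasCoeffDerivAt (fun _ => f) 0 t :=
  ⟨⟨f.natDegree + 1, Eventually.of_forall fun _ _ hi =>
    coeff_eq_zero_of_natDegree_lt hi⟩, fun _ => by simpa using hasDerivAt_const _ _⟩

theorem sub (hP : HasCoeffDerivAt P P' t) (hQ : HasCoeffDerivAt Q Q' t) :
    HasCoeffDerivAt (fun s => P s - Q s) (P' - Q') t := by
  obtain ⟨⟨N, hN⟩, hd⟩ := hP
  obtain ⟨⟨M, hM⟩, he⟩ := hQ
  refine ⟨⟨max N M, ?_⟩, fun i => ?_⟩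
  · filter_upwards [hN, hM] with s h1 h2 i hi
    rw [coeff_sub, h1 i (le_trans (le_max_left _ _) hi), h2 i (le_trans (le_max_right _ _) hi),
      sub_zero]
  · simpa using (hd i).fun_sub (he i)

theorem add (hP : HasCoeffDerivAt P P' t) (hQ : HasCoeffDerivAt Q Q' t) :
    HasCoeffDerivAt (fun s => P s + Q s) (P' + Q') t := by
  obtain ⟨⟨N, hN⟩, hd⟩ := hP
  obtain ⟨⟨M, hM⟩, he⟩ := hQ
  refine ⟨⟨max N M, ?_⟩, fun i => ?_⟩
  · filter_upwards [hN, hM] with s h1 h2 i hi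
    rw [coeff_add, h1 i (le_trans (le_max_left _ _) hi), h2 i (le_trans (le_max_right _ _) hi),
      add_zero]
  · simpa using (hd i).fun_add (he i)

theorem mul (hP : HasCoeffDerivAt P P' t) (hQ : HasCoeffDerivAt Q Q' t) :
    HasCoeffDerivAt (fun s => P s * Q s) (P' * Q t + P t * Q') t := by
  obtain ⟨⟨N, hN⟩, hd⟩ := hP
  obtain ⟨⟨M, hM⟩, he⟩ := hQ
  refine ⟨⟨N + M, ?_⟩, fun i => ?_⟩
  · filter_upwards [hN, hM] with s h1 h2 i hi
    rw [coeff_mul]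
    refine Finset.sum_eq_zero fun x hx => ?_
    have hx := Finset.HasAntidiagonal.mem_antidiagonal.mp hx
    by_cases hx1 : N ≤ x.1
    · rw [h1 _ hx1, zero_mul]
    · rw [h2 _ (by omega), mul_zero]
  · simp only [coeff_mul, coeff_add, ← Finset.sum_add_distrib]
    exact HasDerivAt.fun_sum fun x _ => (hd x.1).mul (he x.2)

theorem C_mul {c : ℝ → ℂ} {c' : ℂ} (hc : HasDerivAt c c' t) (hP : HasCoeffDerivAt P P' t) :
    HasCoeffDerivAt (fun s => C (c s) * P s) (C c' * P t + C (c t) * P') t := by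
  obtain ⟨⟨N, hN⟩, hd⟩ := hP
  refine ⟨⟨N, ?_⟩, fun i => ?_⟩
  · filter_upwards [hN] with s h1 i hi
    rw [coeff_C_mul, h1 i hi, mul_zero]
  · simpa using hc.fun_mul (hd i)

theorem momentFunctional {m : ℕ → ℝ → ℂ} {m' : ℕ → ℂ}
    (hm : ∀ k, HasDerivAt (m k) (m' k) t) (hP : HasCoeffDerivAt P P' t) :
    HasDerivAt (fun s => momentFunctional (fun k => m k s) (P s))
      (DeformedLaguerre.momentFunctional (fun k => m k t) P'
        + DeformedLaguerre.momentFunctional m' (P t)) t := by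
  obtain ⟨N, hN⟩ := hP.1
  rw [momentFunctional_eq_sum m' hN.self_of_nhds, momentFunctional_eq_sum _ (f := P') (N := N)
    (fun i hi => hP.coeff_eq_zero (hN.mono fun s hs => hs i hi)), ← Finset.sum_add_distrib]
  refine HasDerivAt.congr_of_eventuallyEq
    (HasDerivAt.fun_sum fun i _ => (hP.2 i).mul (hm i)) ?_
  filter_upwards [hN] with s hs
  exact momentFunctional_eq_sum _ hs

end HasCoeffDerivAt

/-- The monic orthogonal polynomials. -/
noncomputable def monicPoly (p : ℕ → ℂ[X]) (k : ℕ) : ℂ[X] := C (lead p k)⁻¹ * p k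

namespace IsOrthonormalFor

variable {L : ℂ[X] →ₗ[ℂ] ℂ} {N : ℕ} {p : ℕ → ℂ[X]}

theorem map_monicPoly_mul_self (h : IsOrthonormalFor L N p) {k : ℕ} (hk : k ≤ N) :
    L (monicPoly p k * monicPoly p k) = (lead p k)⁻¹ ^ 2 := by
  rw [monicPoly, show C (lead p k)⁻¹ * p k * (C (lead p k)⁻¹ * p k)
    = C (lead p k)⁻¹ * (C (lead p k)⁻¹ * (p k * p k)) by ring, map_C_mul, map_C_mul,
    h.orthonormal k hk k hk, if_pos rfl]
  ring

theorem coeff_monicPoly_self (h : IsOrthonormalFor L N p) {k : ℕ} (hk : k ≤ N) :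
    (monicPoly p k).coeff k = 1 := by
  rw [monicPoly, coeff_C_mul]
  exact inv_mul_cancel₀ (h.lead_ne_zero hk)

theorem coeff_monicPoly_eq_zero (h : IsOrthonormalFor L N p) {k : ℕ} (hk : k ≤ N) {i : ℕ}
    (hi : k < i) : (monicPoly p k).coeff i = 0 := by
  rw [monicPoly, coeff_C_mul, h.coeff_eq_zero hk hi, mul_zero]

/-- The Gram–Schmidt process. -/
theorem monicPoly_eq (h : IsOrthonormalFor L N p) {k : ℕ} (hk : k ≤ N) :
    monicPoly p k = X ^ k - ∑ j ∈ Finset.range k,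
      C (L (X ^ k * monicPoly p j) / L (monicPoly p j * monicPoly p j)) * monicPoly p j := by
  have key : monicPoly p k - X ^ k + ∑ j ∈ Finset.range k,
      C (L (X ^ k * monicPoly p j) / L (monicPoly p j * monicPoly p j)) * monicPoly p j = 0 := by
    refine h.eq_zero k (by omega) _ (fun i hi => ?_) (fun j hj => ?_)
    · rw [coeff_add, coeff_sub, finsetSum_coeff, Finset.sum_eq_zero, add_zero, coeff_X_pow]
      · rcases hi.eq_or_lt with rfl | hi
        · rw [h.coeff_monicPoly_self hk, if_pos rfl, sub_self]
        · rw [h.coeff_monicPoly_eq_zero hk hi, if_neg (by omega), sub_self]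
      · intro j hj
        rw [Finset.mem_range] at hj
        rw [coeff_C_mul, h.coeff_monicPoly_eq_zero (by omega) (by omega), mul_zero]
    · have e : ∀ i ≤ N, L (monicPoly p i * p j) = (lead p i)⁻¹ * if i = j then 1 else 0 := by
        intro i hi
        rw [monicPoly, mul_assoc, map_C_mul, h.orthonormal i hi j (by omega)]
      rw [add_mul, sub_mul, Finset.sum_mul, map_add, map_sub, map_sum, Finset.sum_eq_single j]
      · rw [mul_assoc, map_C_mul, e k hk, if_neg (by omega), e j (by omega), if_pos rfl,
          h.map_monicPoly_mul_self (by omega)]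
        have h0 := h.lead_ne_zero (k := j) (by omega)
        rw [monicPoly, show X ^ k * (C (lead p j)⁻¹ * p j) = C (lead p j)⁻¹ * (X ^ k * p j) by
          ring, map_C_mul]
        field_simp
        ring
      · intro i hi hij
        rw [Finset.mem_range] at hi
        rw [mul_assoc, map_C_mul, e i (by omega), if_neg hij, mul_zero, mul_zero]
      · intro hj'
        exact absurd (Finset.mem_range.mpr hj) hj'
  linear_combination key

end IsOrthonormalFor

/-! ### Toda-type equations for the recurrence coefficients -/

section Deformation

variable {m : ℕ → ℝ → ℂ} {m' : ℕ → ℝ → ℂ} {I : Set ℝ} {N : ℕ} {p : ℝ → ℕ → ℂ[X]}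

/-- Orthonormality fixes `p t k` only up to a sign that may jump with `t`, so `γ_k` itself need not
be differentiable. The monic polynomials are free of this ambiguity: by Gram–Schmidt they are
rational in the moments and lower monic polynomials, with denominators `γ_j⁻² ≠ 0`. -/
theorem exists_hasCoeffDerivAt_monicPoly (hI : IsOpen I)
    (hm : ∀ t ∈ I, ∀ k, HasDerivAt (m k) (m' k t) t)
    (hp : ∀ t ∈ I, IsOrthonormalFor (momentFunctional fun k => m k t) N (p t)) :
    ∀ k ≤ N, ∀ t ∈ I, ∃ P', HasCoeffDerivAt (fun s => monicPoly (p s) k) P' t := by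
  intro k
  induction k using Nat.strong_induction_on with
  | _ k ih =>
    intro hk t ht
    have hsum : ∀ n ≤ k, ∃ S', HasCoeffDerivAt (fun s => ∑ j ∈ Finset.range n,
        C ((momentFunctional fun k => m k s) (X ^ k * monicPoly (p s) j)
          / (momentFunctional fun k => m k s) (monicPoly (p s) j * monicPoly (p s) j))
          * monicPoly (p s) j) S' t := by
      intro n
      induction n with
      | zero => exact fun _ => ⟨_, by simpa using HasCoeffDerivAt.const 0 t⟩
      | succ n ihn =>
        intro hn
        obtain ⟨S', hS⟩ := ihn (by omega)
        obtain ⟨P', hP⟩ := ih n (by omega) (by omega) t ht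
        have h1 := ((HasCoeffDerivAt.const (X ^ k) t).mul hP).momentFunctional (hm t ht)
        have h2 := (hP.mul hP).momentFunctional (hm t ht)
        have h3 := (hp t ht).map_monicPoly_mul_self (k := n) (by omega)
        have h4 := (hp t ht).lead_ne_zero (k := n) (by omega)
        simp only [Finset.sum_range_succ]
        exact ⟨_, hS.add (HasCoeffDerivAt.C_mul
          (h1.fun_div h2 (by rw [h3]; exact pow_ne_zero _ (inv_ne_zero h4))) hP)⟩
    obtain ⟨S', hS⟩ := hsum k le_rfl
    refine ⟨_, ((HasCoeffDerivAt.const (X ^ k) t).sub hS).congr ?_⟩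
    filter_upwards [hI.mem_nhds ht] with s hs
    exact (hp s hs).monicPoly_eq hk

variable {c : ℂ}

theorem mul_momentFunctional {t : ℂ} {m m' : ℕ → ℂ}
    (hm : ∀ k, t * m' k = (k + c) * m k - m (k + 1)) (f : ℂ[X]) :
    t * momentFunctional m' f = momentFunctional m (X * derivative f)
      + c * momentFunctional m f - momentFunctional m (X * f) := by
  induction f using Polynomial.induction_on' with
  | add f g hf hg =>
    simp only [mul_add, map_add]
    linear_combination hf + hg
  | monomial k a =>
    rw [X_mul_derivative_monomial, X_mul_monomial]
    simp only [momentFunctional_monomial]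
    linear_combination a * hm k

/-- With `π_j` the monic polynomials, differentiate `L(π_{k+1} π_k) = 0`. The term with `π_k'`
vanishes by degree, the one with `π_{k+1}'` is `σ' γ_k⁻²`, and `L'` is removed with
`mul_momentFunctional`. -/
theorem exists_hasDerivAt_sublead_div_lead (hI : IsOpen I)
    (hm : ∀ t ∈ I, ∀ k, HasDerivAt (m k) (m' k t) t)
    (hm' : ∀ t ∈ I, ∀ k, t * m' k t = (k + c) * m k t - m (k + 1) t)
    (hp : ∀ t ∈ I, IsOrthonormalFor (momentFunctional fun k => m k t) N (p t))
    {k : ℕ} (hk : k ≤ N) {t : ℝ} (ht : t ∈ I) :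
    ∃ σ', HasDerivAt (fun s => sublead (p s) k / lead (p s) k) σ' t ∧
      t * σ' = sublead (p t) k / lead (p t) k + recA (p t) k ^ 2 := by
  rcases k with _ | k
  · exact ⟨0, by simpa [sublead] using hasDerivAt_const _ _, by simp [sublead, recA]⟩
  obtain ⟨P', hP⟩ := exists_hasCoeffDerivAt_monicPoly hI hm hp (k + 1) hk t ht
  obtain ⟨Q', hQ⟩ := exists_hasCoeffDerivAt_monicPoly hI hm hp k (by omega) t ht
  have e : ∀ s, (monicPoly (p s) (k + 1)).coeff k
      = sublead (p s) (k + 1) / lead (p s) (k + 1) := by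
    intro s
    rw [monicPoly, coeff_C_mul, sublead]
    ring
  refine ⟨P'.coeff k, by simpa only [e] using hP.2 k, ?_⟩
  have h := hp t ht
  have hP' : ∀ i, k + 1 ≤ i → P'.coeff i = 0 := by
    intro i hi
    refine hP.coeff_eq_zero (c := if i = k + 1 then 1 else 0) ?_
    filter_upwards [hI.mem_nhds ht] with s hs
    split_ifs with h
    · rw [h]
      exact (hp s hs).coeff_monicPoly_self hk
    · exact (hp s hs).coeff_monicPoly_eq_zero hk (by omega)
  have hQ' : ∀ i, k + 1 ≤ i → Q'.coeff i = 0 := by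
    intro i hi
    refine hQ.coeff_eq_zero (c := 0) ?_
    filter_upwards [hI.mem_nhds ht] with s hs
    exact (hp s hs).coeff_monicPoly_eq_zero (by omega) (by omega)
  have hD := (hP.mul hQ).momentFunctional (hm t ht)
  have hD0 := hD.unique ((hasDerivAt_const t 0).congr_of_eventuallyEq (by
    filter_upwards [hI.mem_nhds ht] with s hs
    rw [monicPoly, monicPoly, show C (lead (p s) (k + 1))⁻¹ * p s (k + 1)
      * (C (lead (p s) k)⁻¹ * p s k) = C (lead (p s) (k + 1))⁻¹ * (C (lead (p s) k)⁻¹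
        * (p s (k + 1) * p s k)) by ring, map_C_mul, map_C_mul,
      (hp s hs).orthonormal _ hk _ (by omega), if_neg (by omega)]
    simp))
  have hD1 := mul_momentFunctional (hm' t ht) (monicPoly (p t) (k + 1) * monicPoly (p t) k)
  have h0 := h.lead_ne_zero (k := k) (by omega)
  have h1 := h.lead_ne_zero hk
  have z1 := h.map_mul (k := k) (by omega) (f := P') (fun i hi => hP' i hi)
  have z2 := h.map_mul_eq_zero hk (k + 1) le_rfl Q' hQ'
  have z3 := h.map_mul (k := k) (by omega)
    (f := X * derivative (p t (k + 1)) - C ((k : ℂ) + 1) * p t (k + 1)) (fun i hi => by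
      rw [coeff_sub, coeff_X_mul_derivative, coeff_C_mul]
      rcases (show k + 1 ≤ i by omega).eq_or_lt with rfl | hi
      · push_cast
        ring
      · rw [h.coeff_eq_zero (by omega) hi]
        ring)
  rw [coeff_sub, coeff_X_mul_derivative, coeff_C_mul,
    show (p t (k + 1)).coeff k = sublead (p t) (k + 1) from rfl, sub_mul, map_sub, mul_assoc (C _),
    map_C_mul, h.orthonormal _ hk _ (by omega), if_neg (by omega)] at z3
  have z4 := h.map_X_derivative_mul_eq_zero (j := k) hk (by omega)
  have z5 := h.orthonormal _ hk k (by omega)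
  rw [if_neg (by omega)] at z5
  have z6 := h.map_X_mul_mul_succ hk
  have z7 : recA (p t) (k + 1) = lead (p t) k / lead (p t) (k + 1) := rfl
  simp only [monicPoly] at hD0 hD1
  generalize (lead (p t) k) = a at *
  generalize (lead (p t) (k + 1)) = b at *
  rw [show X * derivative (C b⁻¹ * p t (k + 1) * (C a⁻¹ * p t k))
      = C (b⁻¹ * a⁻¹) * (X * derivative (p t (k + 1)) * p t k)
        + C (b⁻¹ * a⁻¹) * (X * derivative (p t k) * p t (k + 1)) by
      simp only [derivative_mul, derivative_C, C_mul]
      ring,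
    show X * (C b⁻¹ * p t (k + 1) * (C a⁻¹ * p t k))
      = C (b⁻¹ * a⁻¹) * (X * p t k * p t (k + 1)) by rw [C_mul]; ring,
    show C b⁻¹ * p t (k + 1) * (C a⁻¹ * p t k) = C (b⁻¹ * a⁻¹) * (p t (k + 1) * p t k) by
      rw [C_mul]; ring] at hD1
  rw [show C b⁻¹ * p t (k + 1) * (C a⁻¹ * p t k) = C (b⁻¹ * a⁻¹) * (p t (k + 1) * p t k) by
      rw [C_mul]; ring,
    show P' * (C a⁻¹ * p t k) + C b⁻¹ * p t (k + 1) * Q'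
      = C a⁻¹ * (P' * p t k) + C b⁻¹ * (Q' * p t (k + 1)) by ring] at hD0
  simp only [map_add, map_C_mul, z1, z2, z4, z5, z6] at hD0 hD1
  rw [z7] at hD1 ⊢
  have q : P'.coeff k = a ^ 2 * (a⁻¹ * (P'.coeff k / a)) := by field_simp
  have r : -a ^ 2 * (b⁻¹ * a⁻¹ * ((k * sublead (p t) (k + 1)
      - (k + 1) * sublead (p t) (k + 1)) / a) - b⁻¹ * a⁻¹ * (a / b))
      = sublead (p t) (k + 1) / b + (a / b) ^ 2 := by
    field_simp
    ring
  linear_combination t * q + r + t * a ^ 2 * hD0 - a ^ 2 * hD1 - a ^ 2 * b⁻¹ * a⁻¹ * z3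

/-- The quantity is `L(π_k²)` with `π_k` monic. Since `π_k'` has degree below `k`, it is orthogonal
to `π_k` and only the derivative of `L` contributes. -/
theorem exists_hasDerivAt_inv_lead_sq (hI : IsOpen I)
    (hm : ∀ t ∈ I, ∀ k, HasDerivAt (m k) (m' k t) t)
    (hm' : ∀ t ∈ I, ∀ k, t * m' k t = (k + c) * m k t - m (k + 1) t)
    (hp : ∀ t ∈ I, IsOrthonormalFor (momentFunctional fun k => m k t) N (p t))
    {k : ℕ} (hk : k + 1 ≤ N) {t : ℝ} (ht : t ∈ I) :
    ∃ η', HasDerivAt (fun s => (lead (p s) k)⁻¹ ^ 2) η' t ∧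
      t * η' = (2 * k + c - recB (p t) k) * (lead (p t) k)⁻¹ ^ 2 := by
  obtain ⟨P', hP⟩ := exists_hasCoeffDerivAt_monicPoly hI hm hp k (by omega) t ht
  have h := hp t ht
  have hP' : ∀ i, k ≤ i → P'.coeff i = 0 := by
    intro i hi
    refine hP.coeff_eq_zero (c := if i = k then 1 else 0) ?_
    filter_upwards [hI.mem_nhds ht] with s hs
    split_ifs with h
    · rw [h]
      exact (hp s hs).coeff_monicPoly_self (by omega)
    · exact (hp s hs).coeff_monicPoly_eq_zero (by omega) (by omega)
  have hD := (hP.mul hP).momentFunctional (hm t ht)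
  have hD1 := mul_momentFunctional (hm' t ht) (monicPoly (p t) k * monicPoly (p t) k)
  refine ⟨_, hD.congr_of_eventuallyEq ?_, ?_⟩
  · filter_upwards [hI.mem_nhds ht] with s hs
    exact ((hp s hs).map_monicPoly_mul_self (by omega)).symm
  have z1 := h.map_mul_eq_zero (k := k) (by omega) k le_rfl P' hP'
  have z2 := h.map_X_derivative_mul_self (k := k) (by omega)
  have z3 := h.map_X_mul_mul_self hk
  have z4 := h.orthonormal k (by omega) k (by omega)
  rw [if_pos rfl] at z4
  rw [mul_add, hD1]
  simp only [monicPoly]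
  generalize (lead (p t) k)⁻¹ = a at *
  rw [show X * derivative (C a * p t k * (C a * p t k))
      = C (2 * a ^ 2) * (X * derivative (p t k) * p t k) by
      simp only [derivative_mul, derivative_C, C_mul, C_pow, C_ofNat]
      ring,
    show X * (C a * p t k * (C a * p t k)) = C (a ^ 2) * (X * p t k * p t k) by
      rw [C_pow]; ring,
    show C a * p t k * (C a * p t k) = C (a ^ 2) * (p t k * p t k) by rw [C_pow]; ring,
    show P' * (C a * p t k) + C a * p t k * P' = C (2 * a) * (P' * p t k) by
      simp only [C_mul, C_ofNat]
      ring]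
  simp only [map_C_mul, z1, z2, z3, z4]
  ring

theorem exists_hasDerivAt_recA_sq (hI : IsOpen I)
    (hm : ∀ t ∈ I, ∀ k, HasDerivAt (m k) (m' k t) t)
    (hm' : ∀ t ∈ I, ∀ k, t * m' k t = (k + c) * m k t - m (k + 1) t)
    (hp : ∀ t ∈ I, IsOrthonormalFor (momentFunctional fun k => m k t) N (p t))
    {k : ℕ} (hk : k + 2 ≤ N) {t : ℝ} (ht : t ∈ I) :
    ∃ a', HasDerivAt (fun s => recA (p s) (k + 1) ^ 2) a' t ∧
      t * a' = (2 + recB (p t) k - recB (p t) (k + 1)) * recA (p t) (k + 1) ^ 2 := by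
  obtain ⟨x, hx, ex⟩ := exists_hasDerivAt_inv_lead_sq hI hm hm' hp (k := k) (by omega) ht
  obtain ⟨y, hy, ey⟩ := exists_hasDerivAt_inv_lead_sq hI hm hm' hp (k := k + 1) hk ht
  have h0 := (hp t ht).lead_ne_zero (k := k) (by omega)
  have h1 := (hp t ht).lead_ne_zero (k := k + 1) (by omega)
  -- As a ratio of consecutive norms, `a_{k+1}²` has as logarithmic derivative a difference in which
  -- `c` cancels.
  have e : ∀ s, recA (p s) (k + 1) ^ 2
      = (lead (p s) (k + 1))⁻¹ ^ 2 / (lead (p s) k)⁻¹ ^ 2 := by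
    intro s
    rw [recA, div_pow, inv_pow, inv_pow, div_inv_eq_mul, div_eq_inv_mul]
  simp only [e]
  refine ⟨_, hy.fun_div hx (pow_ne_zero _ (inv_ne_zero h0)), ?_⟩
  have h2 : (lead (p t) k)⁻¹ ^ 2 ≠ 0 := pow_ne_zero _ (inv_ne_zero h0)
  generalize (lead (p t) k)⁻¹ ^ 2 = a at *
  generalize (lead (p t) (k + 1))⁻¹ ^ 2 = b at *
  rw [mul_div_assoc', mul_div_assoc', div_eq_div_iff (pow_ne_zero 2 h2) h2]
  push_cast at ey
  linear_combination a ^ 2 * ey - a * b * ex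

end Deformation

end DeformedLaguerre

/-! ### Analysis of the rescaled weight -/

namespace DeformedLaguerre

open Filter Topology Set Asymptotics

/-- The weight `|s - 1| ^ α s ^ ν exp (-t s)`, which has its singularity at the fixed point `1`. -/
noncomputable def scaledWeight (α ν t s : ℝ) : ℝ := |s - 1| ^ α * s ^ ν * Real.exp (-(t * s))

theorem measurable_scaledWeight (α ν t : ℝ) : Measurable (scaledWeight α ν t) := by
  unfold scaledWeight
  fun_prop

theorem scaledWeight_nonneg (α ν t : ℝ) {s : ℝ} (hs : 0 < s) : 0 ≤ scaledWeight α ν t s := by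
  unfold scaledWeight
  positivity

theorem mul_scaledWeight (α ν t : ℝ) {s : ℝ} (hs : 0 < s) :
    s * scaledWeight α ν t s = scaledWeight α (ν + 1) t s := by
  unfold scaledWeight
  rw [Real.rpow_add_one hs.ne']
  ring

theorem scaledWeight_isBigO (α ν : ℝ) {t : ℝ} (ht : 0 < t) :
    scaledWeight α ν t =O[atTop] fun s => Real.exp (-(t / 2) * s) := by
  -- Each of the two powers costs a factor `exp (t s / 4)`, which leaves `exp (-t s / 2)`.
  have hb : 0 < t / 4 := by linarith
  have h1 : (fun s : ℝ => |s - 1| ^ α) =O[atTop] fun s => Real.exp (t / 4 * s) := by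
    have ht : Tendsto (fun s : ℝ => s - 1) atTop atTop := tendsto_atTop_add_const_right _ _ tendsto_id
    refine (((isLittleO_rpow_exp_pos_mul_atTop α hb).comp_tendsto ht).isBigO.trans ?_).congr'
      ?_ EventuallyEq.rfl
    · refine IsBigO.of_bound 1 (Eventually.of_forall fun s => ?_)
      simp only [Function.comp, Real.norm_eq_abs, Real.abs_exp, one_mul]
      exact Real.exp_le_exp.mpr (by nlinarith)
    · filter_upwards [eventually_ge_atTop 1] with s hs
      simp only [Function.comp]
      rw [abs_of_nonneg (by linarith)]
  have h2 := (isLittleO_rpow_exp_pos_mul_atTop ν hb).isBigO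
  refine ((h1.mul h2).mul (isBigO_refl (fun s => Real.exp (-(t * s))) atTop)).congr_right ?_
  intro s
  rw [← Real.exp_add, ← Real.exp_add]
  congr 1
  ring

theorem tendsto_scaledWeight (α ν : ℝ) {t : ℝ} (ht : 0 < t) :
    Tendsto (scaledWeight α ν t) atTop (𝓝 0) := by
  refine (scaledWeight_isBigO α ν ht).trans_tendsto ?_
  have h : Tendsto (fun s : ℝ => t / 2 * s) atTop atTop :=
    tendsto_id.const_mul_atTop (by linarith)
  simpa [Function.comp_def] using Real.tendsto_exp_neg_atTop_nhds_zero.comp h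

theorem continuousOn_scaledWeight_Ioi {ν : ℝ} (α t : ℝ) :
    ContinuousOn (scaledWeight α ν t) (Ioi 1) := by
  unfold scaledWeight
  refine ContinuousOn.mul (ContinuousOn.mul ?_ ?_) (by fun_prop)
  · exact ContinuousOn.rpow_const (by fun_prop) fun s hs =>
      Or.inl (abs_ne_zero.mpr (sub_ne_zero.mpr (ne_of_gt hs)))
  · exact ContinuousOn.rpow_const (by fun_prop) fun s hs => Or.inl (by linarith [mem_Ioi.mp hs])

theorem continuous_scaledWeight {α ν : ℝ} (hα : 0 ≤ α) (hν : 0 ≤ ν) (t : ℝ) :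
    Continuous (scaledWeight α ν t) := by
  unfold scaledWeight
  refine Continuous.mul (Continuous.mul ?_ ?_) (by fun_prop)
  · exact Continuous.rpow_const (by fun_prop) fun _ => Or.inr hα
  · exact Continuous.rpow_const (by fun_prop) fun _ => Or.inr hν

/-- The cuts at `1/2`, `1` and `2` isolate the singularity at `0`, the two sides of the one at `1`,
and the exponential tail. -/
theorem integrableOn_scaledWeight {α ν t : ℝ} (hα : -1 < α) (hν : -1 < ν) (ht : 0 < t) :
    IntegrableOn (scaledWeight α ν t) (Ioi 0) := by
  have h1 : IntegrableOn (scaledWeight α ν t) (Ioc 0 (1 / 2)) := by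
    have h := (intervalIntegral.intervalIntegrable_rpow' (a := 0) (b := 1 / 2) hν).mul_continuousOn
      (g := fun s => |s - 1| ^ α * Real.exp (-(t * s))) (by
        rw [uIcc_of_le (by norm_num)]
        refine ContinuousOn.mul (ContinuousOn.rpow_const (by fun_prop) fun s hs =>
          Or.inl (abs_ne_zero.mpr (sub_ne_zero.mpr (by linarith [hs.2])))) (by fun_prop))
    rw [intervalIntegrable_iff_integrableOn_Ioc_of_le (by norm_num)] at h
    refine h.congr_fun (fun s _ => ?_) measurableSet_Ioc
    simp only [scaledWeight]
    ring
  have key : ∀ a b : ℝ, 0 < a → a ≤ b → IntegrableOn (fun s => |s - 1| ^ α) (Ioc a b) →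
      IntegrableOn (scaledWeight α ν t) (Ioc a b) := by
    intro a b ha hab h
    rw [← intervalIntegrable_iff_integrableOn_Ioc_of_le hab] at h ⊢
    have h' := h.mul_continuousOn (g := fun s => s ^ ν * Real.exp (-(t * s))) (by
      rw [uIcc_of_le hab]
      exact ContinuousOn.mul (ContinuousOn.rpow_const (by fun_prop) fun s hs =>
          Or.inl (by linarith [hs.1])) (by fun_prop))
    refine h'.congr fun s _ => ?_
    simp only [scaledWeight]
    ring
  have h2 : IntegrableOn (scaledWeight α ν t) (Ioc (1 / 2) 1) := by
    refine key _ _ (by norm_num) (by norm_num) ?_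
    have h := (intervalIntegral.intervalIntegrable_rpow' (a := 1 / 2) (b := 0) hα).comp_sub_left 1
    norm_num at h
    rw [intervalIntegrable_iff_integrableOn_Ioc_of_le (by norm_num)] at h
    refine h.congr_fun (fun s hs => ?_) measurableSet_Ioc
    simp only
    rw [abs_of_nonpos (by linarith [hs.2]), neg_sub]
  have h3 : IntegrableOn (scaledWeight α ν t) (Ioc 1 2) := by
    refine key _ _ (by norm_num) (by norm_num) ?_
    have h := (intervalIntegral.intervalIntegrable_rpow' (a := 0) (b := 1) hα).comp_sub_right 1
    norm_num at h
    rw [intervalIntegrable_iff_integrableOn_Ioc_of_le (by norm_num)] at h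
    refine h.congr_fun (fun s hs => ?_) measurableSet_Ioc
    simp only
    rw [abs_of_nonneg (by linarith [hs.1])]
  have h4 : IntegrableOn (scaledWeight α ν t) (Ioi 2) :=
    integrable_of_isBigO_exp_neg (b := t / 2) (by linarith)
      ((continuousOn_scaledWeight_Ioi α t).mono fun s hs => by
        have := mem_Ici.mp hs
        exact mem_Ioi.mpr (by linarith)) (scaledWeight_isBigO α ν ht)
  have h := ((h1.union h2).union h3).union h4
  rwa [Ioc_union_Ioc_eq_Ioc (by norm_num) (by norm_num),
    Ioc_union_Ioc_eq_Ioc (by norm_num) (by norm_num), Ioc_union_Ioi_eq_Ioi (by norm_num)] at h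

theorem hasDerivAt_setIntegral_scaledWeight {α ν t : ℝ} (hα : -1 < α) (hν : -1 < ν) (ht : 0 < t)
    {S : Set ℝ} (hS : MeasurableSet S) (hS0 : S ⊆ Ioi 0) :
    HasDerivAt (fun t => ∫ s in S, scaledWeight α ν t s)
      (-∫ s in S, scaledWeight α (ν + 1) t s) t := by
  have hpos : ∀ᵐ s ∂volume.restrict S, s ∈ Ioi (0 : ℝ) :=
    (ae_restrict_mem hS).mono fun s hs => hS0 hs
  -- Parameters are kept above `t / 2`, where `exp (-x s) ≤ exp (-t s / 2)` for `s > 0`; this gives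
  -- the dominating function.
  have h := (hasDerivAt_integral_of_dominated_loc_of_deriv_le (μ := volume.restrict S)
    (F := fun t s => scaledWeight α ν t s) (F' := fun t s => -scaledWeight α (ν + 1) t s)
    (bound := scaledWeight α (ν + 1) (t / 2)) (x₀ := t) (s := Ioi (t / 2))
    (Ioi_mem_nhds (by linarith))
    (Eventually.of_forall fun x => (measurable_scaledWeight α ν x).aestronglyMeasurable)
    ((integrableOn_scaledWeight hα hν ht).mono_set hS0)
    (measurable_scaledWeight α (ν + 1) t).neg.aestronglyMeasurable ?_
    ((integrableOn_scaledWeight hα (by linarith) (by linarith)).mono_set hS0) ?_).2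
  · rwa [integral_neg] at h
  · filter_upwards [hpos] with s hs x hx
    have hs : 0 < s := hs
    have hx : t / 2 < x := hx
    rw [norm_neg, Real.norm_of_nonneg (scaledWeight_nonneg _ _ _ hs)]
    unfold scaledWeight
    gcongr
  · filter_upwards [hpos] with s hs x _
    rw [← mul_scaledWeight α ν x hs]
    unfold scaledWeight
    have h := (((hasDerivAt_id x).mul_const s).fun_neg.exp).const_mul (|s - 1| ^ α * s ^ ν)
    simp only [id] at h
    refine h.congr_deriv ?_
    ring

/-- The function differentiated is `s (s - 1)` times the weight; the minus sign is that of `s - 1`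
on `(0, 1)`. -/
theorem hasDerivAt_scaledWeight_of_lt {α ν t s : ℝ} (h0 : 0 < s) (hs : s < 1) :
    HasDerivAt (fun s => -scaledWeight (α + 1) (ν + 1) t s)
      ((α + ν + 2 + t) * scaledWeight α (ν + 1) t s - (ν + 1) * scaledWeight α ν t s
        - t * scaledWeight α (ν + 2) t s) s := by
  have h1 : HasDerivAt (fun s : ℝ => (1 - s) ^ (α + 1) * s ^ (ν + 1) * Real.exp (-(t * s)))
      _ s :=
    ((((hasDerivAt_id s).const_sub 1).rpow_const (Or.inl (by simp only [id]; linarith))).fun_mul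
      (Real.hasDerivAt_rpow_const (p := ν + 1) (Or.inl h0.ne'))).fun_mul
      (((hasDerivAt_id s).const_mul t).fun_neg.exp)
  refine (h1.fun_neg.congr_of_eventuallyEq ?_).congr_deriv ?_
  · filter_upwards [Iio_mem_nhds hs] with x hx
    rw [scaledWeight, abs_of_neg (by linarith [mem_Iio.mp hx]), neg_sub]
  · rw [show ν + 2 = ν + 1 + 1 by ring, ← mul_scaledWeight α (ν + 1) t h0,
      ← mul_scaledWeight α ν t h0, scaledWeight, abs_of_neg (by linarith), neg_sub]
    simp only [id, add_sub_cancel_right]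
    rw [Real.rpow_add_one h0.ne', Real.rpow_add_one (by linarith)]
    ring

theorem hasDerivAt_scaledWeight_of_gt {α ν t s : ℝ} (hs : 1 < s) :
    HasDerivAt (scaledWeight (α + 1) (ν + 1) t)
      ((α + ν + 2 + t) * scaledWeight α (ν + 1) t s - (ν + 1) * scaledWeight α ν t s
        - t * scaledWeight α (ν + 2) t s) s := by
  have h0 : 0 < s := by linarith
  have h1 : HasDerivAt (fun s : ℝ => (s - 1) ^ (α + 1) * s ^ (ν + 1) * Real.exp (-(t * s)))
      _ s :=
    ((((hasDerivAt_id s).sub_const 1).rpow_const (Or.inl (by simp only [id]; linarith))).fun_mul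
      (Real.hasDerivAt_rpow_const (p := ν + 1) (Or.inl h0.ne'))).fun_mul
      (((hasDerivAt_id s).const_mul t).fun_neg.exp)
  refine (h1.congr_of_eventuallyEq ?_).congr_deriv ?_
  · filter_upwards [Ioi_mem_nhds hs] with x hx
    rw [scaledWeight, abs_of_pos (by linarith [mem_Ioi.mp hx])]
  · rw [show ν + 2 = ν + 1 + 1 by ring, ← mul_scaledWeight α (ν + 1) t h0,
      ← mul_scaledWeight α ν t h0, scaledWeight, abs_of_pos (by linarith)]
    simp only [id, add_sub_cancel_right]
    rw [Real.rpow_add_one h0.ne', Real.rpow_add_one (by linarith)]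
    ring

theorem integrableOn_pearson {α ν t : ℝ} (hα : -1 < α) (hν : -1 < ν) (ht : 0 < t) :
    IntegrableOn (fun s => (α + ν + 2 + t) * scaledWeight α (ν + 1) t s
      - (ν + 1) * scaledWeight α ν t s - t * scaledWeight α (ν + 2) t s) (Ioi 0) :=
  (((integrableOn_scaledWeight hα (by linarith) ht).const_mul _).sub
    ((integrableOn_scaledWeight hα hν ht).const_mul _)).sub
    ((integrableOn_scaledWeight hα (by linarith) ht).const_mul _)

theorem setIntegral_pearson {α ν t : ℝ} (hα : -1 < α) (hν : -1 < ν) (ht : 0 < t)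
    {S : Set ℝ} (hS0 : S ⊆ Ioi 0) :
    ∫ s in S, ((α + ν + 2 + t) * scaledWeight α (ν + 1) t s
      - (ν + 1) * scaledWeight α ν t s - t * scaledWeight α (ν + 2) t s) =
    (α + ν + 2 + t) * (∫ s in S, scaledWeight α (ν + 1) t s)
      - (ν + 1) * (∫ s in S, scaledWeight α ν t s) - t * ∫ s in S, scaledWeight α (ν + 2) t s := by
  have h1 := (integrableOn_scaledWeight hα (ν := ν + 1) (by linarith) ht).mono_set hS0
  have h2 := (integrableOn_scaledWeight hα hν ht).mono_set hS0
  have h3 := (integrableOn_scaledWeight hα (ν := ν + 2) (by linarith) ht).mono_set hS0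
  have h12 : IntegrableOn (fun s => (α + ν + 2 + t) * scaledWeight α (ν + 1) t s
      - (ν + 1) * scaledWeight α ν t s) S := (h1.const_mul _).sub (h2.const_mul _)
  rw [integral_sub h12 (h3.const_mul _),
    integral_sub (h1.const_mul _) (h2.const_mul _), integral_const_mul, integral_const_mul,
    integral_const_mul]

/-- The antiderivative vanishes at `0` and `1` because `ν + 1 > 0` and `α + 1 > 0`. Since the
relation holds on `(0, 1)` and `(1, ∞)` separately, it survives any linear combination of the two
integrals. -/
theorem pearson_Ioo {α ν t : ℝ} (hα : -1 < α) (hν : -1 < ν) (ht : 0 < t) :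
    (α + ν + 2 + t) * (∫ s in Ioo 0 1, scaledWeight α (ν + 1) t s)
      - (ν + 1) * (∫ s in Ioo 0 1, scaledWeight α ν t s)
      - t * ∫ s in Ioo 0 1, scaledWeight α (ν + 2) t s = 0 := by
  rw [← setIntegral_pearson hα hν ht fun s hs => hs.1, ← integral_Ioc_eq_integral_Ioo,
    ← intervalIntegral.integral_of_le zero_le_one,
    intervalIntegral.integral_eq_sub_of_hasDerivAt_of_le zero_le_one
      (continuous_scaledWeight (by linarith) (by linarith) t).neg.continuousOn
      (fun s hs => hasDerivAt_scaledWeight_of_lt hs.1 hs.2) ?_]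
  · simp [scaledWeight, Real.zero_rpow (show α + 1 ≠ 0 by linarith),
      Real.zero_rpow (show ν + 1 ≠ 0 by linarith)]
  · rw [intervalIntegrable_iff_integrableOn_Ioc_of_le zero_le_one]
    exact (integrableOn_pearson hα hν ht).mono_set fun s hs => hs.1

theorem pearson_Ioi {α ν t : ℝ} (hα : -1 < α) (hν : -1 < ν) (ht : 0 < t) :
    (α + ν + 2 + t) * (∫ s in Ioi 1, scaledWeight α (ν + 1) t s)
      - (ν + 1) * (∫ s in Ioi 1, scaledWeight α ν t s)
      - t * ∫ s in Ioi 1, scaledWeight α (ν + 2) t s = 0 := by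
  have hsub : Ioi (1 : ℝ) ⊆ Ioi 0 := Ioi_subset_Ioi zero_le_one
  rw [← setIntegral_pearson hα hν ht hsub,
    integral_Ioi_of_hasDerivAt_of_tendsto
      (continuous_scaledWeight (by linarith) (by linarith) t).continuousWithinAt
      (fun s hs => hasDerivAt_scaledWeight_of_gt hs)
      ((integrableOn_pearson hα hν ht).mono_set hsub)
      (tendsto_scaledWeight (α + 1) (ν + 1) ht)]
  simp [scaledWeight, Real.zero_rpow (show α + 1 ≠ 0 by linarith)]

end DeformedLaguerre

/-! ### Moments of the deformed Laguerre weight -/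

namespace DeformedLaguerre

open Filter Topology Set Polynomial

/-- The moments of the weight. -/
noncomputable def moment (α μ ζ : ℝ) (ω : ℂ) (k : ℕ) (t : ℝ) : ℂ :=
  ∫ x in Ioi (0 : ℝ), (x : ℂ) ^ k * weight α μ ζ ω t x

variable {α μ ζ t : ℝ} {ω : ℂ}

theorem weight_mul_of_lt {s : ℝ} (k : ℕ) (ht : 0 < t) (h0 : 0 < s) (h1 : s < 1) :
    ((t * s : ℝ) : ℂ) ^ k * weight α μ ζ ω t (t * s)
      = ((t ^ (α + μ + k) : ℝ) : ℂ) * ω * (scaledWeight α (μ + k) t s : ℂ) := by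
  have e : t * s - t < 0 := by nlinarith
  have e' : -(t * s - t) = t * (1 - s) := by ring
  rw [weight, heaviside, if_neg e.not_gt, branchPow, if_neg e.not_ge, e', scaledWeight,
    abs_of_neg (by linarith), neg_sub, Real.mul_rpow ht.le (by linarith),
    Real.mul_rpow ht.le h0.le, Real.rpow_add ht, Real.rpow_add ht, Real.rpow_add h0,
    Real.rpow_natCast, Real.rpow_natCast]
  push_cast
  ring

theorem weight_mul_of_gt {s : ℝ} (k : ℕ) (ht : 0 < t) (h1 : 1 < s) :
    ((t * s : ℝ) : ℂ) ^ k * weight α μ ζ ω t (t * s)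
      = ((t ^ (α + μ + k) : ℝ) : ℂ) * (1 - ζ) * (scaledWeight α (μ + k) t s : ℂ) := by
  have h0 : 0 < s := by linarith
  have e : 0 < t * s - t := by nlinarith
  have e' : t * s - t = t * (s - 1) := by ring
  rw [weight, heaviside, if_pos e, branchPow, if_pos e.le, e', scaledWeight,
    abs_of_pos (by linarith), Real.mul_rpow ht.le (by linarith),
    Real.mul_rpow ht.le h0.le, Real.rpow_add ht, Real.rpow_add ht, Real.rpow_add h0,
    Real.rpow_natCast, Real.rpow_natCast]
  push_cast
  ring

theorem integrableOn_weight_mul (hα : -1 < α) (hμ : -1 < μ) (ht : 0 < t) (k : ℕ) :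
    IntegrableOn (fun s => ((t * s : ℝ) : ℂ) ^ k * weight α μ ζ ω t (t * s)) (Ioc 0 1) ∧
    IntegrableOn (fun s => ((t * s : ℝ) : ℂ) ^ k * weight α μ ζ ω t (t * s)) (Ioi 1) := by
  have hk : -1 < μ + k := by
    have := k.cast_nonneg (α := ℝ)
    linarith
  have h := integrableOn_scaledWeight hα hk ht
  constructor
  · rw [integrableOn_Ioc_iff_integrableOn_Ioo]
    exact IntegrableOn.congr_fun (((h.mono_set fun s hs => hs.1).ofReal).const_mul _)
      (fun s hs => (weight_mul_of_lt k ht hs.1 hs.2).symm) measurableSet_Ioo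
  · exact IntegrableOn.congr_fun
      (((h.mono_set (Ioi_subset_Ioi zero_le_one)).ofReal).const_mul _)
      (fun s hs => (weight_mul_of_gt k ht hs).symm) measurableSet_Ioi

theorem integrableOn_pow_mul_weight (hα : -1 < α) (hμ : -1 < μ) (ht : 0 < t) (k : ℕ) :
    IntegrableOn (fun x : ℝ => (x : ℂ) ^ k * weight α μ ζ ω t x) (Ioi 0) := by
  have h := integrableOn_weight_mul (ζ := ζ) (ω := ω) hα hμ ht k
  have h' := h.1.union h.2
  rw [Ioc_union_Ioi_eq_Ioi zero_le_one] at h'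
  have h2 := (integrableOn_Ioi_comp_mul_left_iff
    (fun x : ℝ => (x : ℂ) ^ k * weight α μ ζ ω t x) 0 ht).mp h'
  rwa [mul_zero] at h2

theorem moment_eq (hα : -1 < α) (hμ : -1 < μ) (ht : 0 < t) (k : ℕ) :
    moment α μ ζ ω k t = ((t ^ (α + μ + k + 1) : ℝ) : ℂ) *
      (ω * ((∫ s in Ioo 0 1, scaledWeight α (μ + k) t s : ℝ) : ℂ)
        + (1 - ζ) * ((∫ s in Ioi 1, scaledWeight α (μ + k) t s : ℝ) : ℂ)) := by
  have h := integrableOn_weight_mul (ζ := ζ) (ω := ω) hα hμ ht k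
  have e := integral_comp_mul_left_Ioi
    (fun x : ℝ => (x : ℂ) ^ k * weight α μ ζ ω t x) 0 ht
  rw [mul_zero] at e
  rw [moment, Real.rpow_add_one ht.ne']
  have e2 : ∫ x in Ioi (0 : ℝ), (x : ℂ) ^ k * weight α μ ζ ω t x
      = t * ∫ s in Ioi (0 : ℝ), ((t * s : ℝ) : ℂ) ^ k * weight α μ ζ ω t (t * s) := by
    rw [e, Complex.real_smul, ← mul_assoc, ← Complex.ofReal_mul, mul_inv_cancel₀ ht.ne']
    simp
  rw [e2, ← Ioc_union_Ioi_eq_Ioi zero_le_one, setIntegral_union (Ioc_disjoint_Ioi le_rfl)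
    measurableSet_Ioi h.1 h.2, integral_Ioc_eq_integral_Ioo,
    setIntegral_congr_fun measurableSet_Ioo (fun s hs => weight_mul_of_lt k ht hs.1 hs.2),
    setIntegral_congr_fun measurableSet_Ioi (fun s hs => weight_mul_of_gt k ht hs),
    integral_const_mul, integral_const_mul, integral_complex_ofReal, integral_complex_ofReal]
  push_cast
  ring

theorem form_eq_momentFunctional (hα : -1 < α) (hμ : -1 < μ) (ht : 0 < t) (f g : ℂ[X]) :
    form (weight α μ ζ ω t) f g = momentFunctional (fun k => moment α μ ζ ω k t) (f * g) := by
  rw [momentFunctional_eq_sum _ (N := (f * g).natDegree + 1)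
    (fun i hi => coeff_eq_zero_of_natDegree_lt hi), form]
  have e : ∀ x : ℝ, f.eval (x : ℂ) * g.eval (x : ℂ) * weight α μ ζ ω t x
      = ∑ i ∈ Finset.range ((f * g).natDegree + 1),
        (f * g).coeff i * ((x : ℂ) ^ i * weight α μ ζ ω t x) := by
    intro x
    rw [← eval_mul, eval_eq_sum_range, Finset.sum_mul]
    exact Finset.sum_congr rfl fun i _ => by ring
  simp only [e]
  rw [integral_finsetSum _ fun i _ => (integrableOn_pow_mul_weight hα hμ ht i).const_mul _]
  exact Finset.sum_congr rfl fun i _ => integral_const_mul _ _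

theorem hasDerivAt_moment (hα : -1 < α) (hμ : -1 < μ) (ht : 0 < t) (k : ℕ) :
    HasDerivAt (moment α μ ζ ω k)
      (((k + (α + μ + 1)) * moment α μ ζ ω k t - moment α μ ζ ω (k + 1) t) / t) t := by
  have hk : -1 < μ + k := by
    have := k.cast_nonneg (α := ℝ)
    linarith
  have h1 := (hasDerivAt_setIntegral_scaledWeight hα hk ht measurableSet_Ioo
    (S := Ioo 0 1) fun s hs => hs.1).ofReal_comp
  have h2 := (hasDerivAt_setIntegral_scaledWeight hα hk ht measurableSet_Ioi
    (S := Ioi 1) (Ioi_subset_Ioi zero_le_one)).ofReal_comp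
  have h3 := (Real.hasDerivAt_rpow_const (p := α + μ + k + 1) (Or.inl ht.ne')).ofReal_comp
  have h := h3.fun_mul ((h1.const_mul ω).fun_add (h2.const_mul (1 - (ζ : ℂ))))
  refine (h.congr_of_eventuallyEq ?_).congr_deriv ?_
  · filter_upwards [Ioi_mem_nhds ht] with x hx
    exact moment_eq hα hμ hx k
  · rw [moment_eq hα hμ ht, moment_eq hα hμ ht]
    have ht' : (t : ℂ) ≠ 0 := Complex.ofReal_ne_zero.mpr ht.ne'
    have e1 : α + μ + ((k + 1 : ℕ) : ℝ) + 1 = α + μ + k + 1 + 1 := by push_cast; ring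
    have e2 : μ + ((k + 1 : ℕ) : ℝ) = μ + k + 1 := by push_cast; ring
    rw [eq_div_iff ht', e1, e2, Real.rpow_add_one ht.ne' (α + μ + k + 1),
      Real.rpow_add_one ht.ne' (α + μ + k), add_sub_cancel_right]
    push_cast
    ring

theorem moment_pearson (hα : -1 < α) (hμ : -1 < μ) (ht : 0 < t) (k : ℕ) :
    (k + (α + μ + 2 + t)) * moment α μ ζ ω (k + 1) t - (k + (μ + 1)) * t * moment α μ ζ ω k t
      - moment α μ ζ ω (k + 2) t = 0 := by
  have hk : -1 < μ + k := by
    have := k.cast_nonneg (α := ℝ)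
    linarith
  have h1 := congrArg (fun x : ℝ => (x : ℂ)) (pearson_Ioo hα hk ht)
  have h2 := congrArg (fun x : ℝ => (x : ℂ)) (pearson_Ioi hα hk ht)
  rw [moment_eq hα hμ ht, moment_eq hα hμ ht, moment_eq hα hμ ht]
  have e1 : α + μ + ((k + 1 : ℕ) : ℝ) + 1 = α + μ + k + 1 + 1 := by push_cast; ring
  have e2 : α + μ + ((k + 2 : ℕ) : ℝ) + 1 = α + μ + k + 1 + 1 + 1 := by push_cast; ring
  have e3 : μ + ((k + 1 : ℕ) : ℝ) = μ + k + 1 := by push_cast; ring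
  have e4 : μ + ((k + 2 : ℕ) : ℝ) = μ + k + 2 := by push_cast; ring
  rw [e1, e2, e3, e4, Real.rpow_add_one ht.ne' (α + μ + k + 1 + 1),
    Real.rpow_add_one ht.ne' (α + μ + k + 1)]
  simp only [Complex.ofReal_sub, Complex.ofReal_mul, Complex.ofReal_add, Complex.ofReal_one,
    Complex.ofReal_ofNat, Complex.ofReal_natCast, Complex.ofReal_zero] at h1 h2 ⊢
  linear_combination ((t ^ (α + μ + k + 1) : ℝ) : ℂ) * t * (ω * h1 + (1 - (ζ : ℂ)) * h2)

theorem isPearson_moment (hα : -1 < α) (hμ : -1 < μ) (ht : 0 < t) :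
    IsPearson (momentFunctional fun k => moment α μ ζ ω k t) α μ t := by
  intro f
  induction f using Polynomial.induction_on' with
  | add f g hf hg =>
    simp only [mul_add, map_add]
    linear_combination hf + hg
  | monomial k a =>
    rw [X_mul_derivative_monomial]
    simp only [X_mul_monomial, momentFunctional_monomial]
    linear_combination a * moment_pearson (ζ := ζ) (ω := ω) hα hμ ht k

theorem IsOrthonormalUpTo.isOrthonormalFor {N : ℕ} {p : ℕ → ℂ[X]} (hα : -1 < α) (hμ : -1 < μ)
    (ht : 0 < t) (h : IsOrthonormalUpTo (weight α μ ζ ω t) N p) :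
    IsOrthonormalFor (momentFunctional fun k => moment α μ ζ ω k t) N p :=
  ⟨h.degree_eq, fun i hi j hj => by
    rw [← form_eq_momentFunctional hα hμ ht, h.orthonormal i hi j hj]⟩

end DeformedLaguerre

/-! ### The two differential equations -/

theorem mainTheorem3 (α μ ζ : ℝ) (ω : ℂ) (hα : -1 < α) (hμ : -1 < μ) (hζ : ζ < 1) (n : ℕ)
    (I : Set ℝ) (hI : IsOpen I) (hIpos : ∀ t ∈ I, 0 < t)
    (p : ℝ → ℕ → Polynomial ℂ)
    (hp : ∀ t ∈ I, IsOrthonormalUpTo (weight α μ ζ ω t) (n + 1) (p t))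
    (θ κ : ℝ → ℂ)
    (hθ : ∀ t, θ t = theta α μ t (p t) n)
    (hκ : ∀ t, κ t = kappa μ t (p t) n) :
    ∀ t ∈ I, DifferentiableAt ℝ θ t ∧ DifferentiableAt ℝ κ t ∧
      t * deriv θ t = 2 * κ t + (2 * n + α + 1 + μ + t + θ t) * θ t ∧
      (θ t ≠ 0 → θ t + t ≠ 0 →
        t * deriv κ t =
          (1 / (θ t + t) + 1 / θ t) * κ t ^ 2
          + (2 * n + α + μ + 1 - (2 * n + α + μ) * (t / (θ t + t))) * κ t
          - (n ^ 2 + (n + μ / 2) * (α + μ)) * t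
          - μ ^ 2 * t ^ 2 / (4 * θ t)
          + (n + μ / 2) * (n + α + μ / 2) * (t ^ 2 / (θ t + t))) := by
  intro t ht
  have ht0 := hIpos t ht
  have htC : (t : ℂ) ≠ 0 := Complex.ofReal_ne_zero.mpr ht0.ne'
  have hm : ∀ t ∈ I, ∀ k, HasDerivAt (moment α μ ζ ω k)
      (((k + (α + μ + 1)) * moment α μ ζ ω k t - moment α μ ζ ω (k + 1) t) / t) t :=
    fun t ht k => hasDerivAt_moment hα hμ (hIpos t ht) k
  have hm' : ∀ t ∈ I, ∀ k : ℕ, (t : ℂ)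
      * (((k + (α + μ + 1)) * moment α μ ζ ω k t - moment α μ ζ ω (k + 1) t) / t)
      = (k + (α + μ + 1 : ℂ)) * moment α μ ζ ω k t - moment α μ ζ ω (k + 1) t :=
    fun t ht k => mul_div_cancel₀ _ (Complex.ofReal_ne_zero.mpr (hIpos t ht).ne')
  have ho := fun t ht => (hp t ht).isOrthonormalFor hα hμ (hIpos t ht)
  have hP := isPearson_moment (ζ := ζ) (ω := ω) hα hμ ht0
  obtain ⟨x, hx, ex⟩ := exists_hasDerivAt_sublead_div_lead hI hm hm' ho (k := n) (by omega) ht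
  obtain ⟨y, hy, ey⟩ := exists_hasDerivAt_sublead_div_lead hI hm hm' ho (k := n + 1) le_rfl ht
  -- For `n = 0` the index `n - 1` is `0`, which is harmless since `recA p 0 = 0`.
  have hA : ∃ a', HasDerivAt (fun s => recA (p s) n ^ 2) a' t ∧
      t * a' = (2 + recB (p t) (n - 1) - recB (p t) n) * recA (p t) n ^ 2 := by
    rcases n with _ | m
    · exact ⟨0, by simpa [recA] using hasDerivAt_const _ _, by simp [recA]⟩
    · exact exists_hasDerivAt_recA_sq hI hm hm' ho le_rfl ht
  obtain ⟨a', ha, ea⟩ := hA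
  have eθ : θ = fun t : ℝ => sublead (p t) n / lead (p t) n
      - sublead (p t) (n + 1) / lead (p t) (n + 1) - 2 * n - 1 - α - μ - t := by
    funext t
    rw [hθ, theta, recB]
  have eκ : κ = fun t : ℝ => ((n : ℂ) + μ / 2) * t + recA (p t) n ^ 2
      + sublead (p t) n / lead (p t) n := by
    funext t
    rw [hκ, kappa_eq_sublead]
  have dθ : HasDerivAt θ (x - y - 1) t := by
    rw [eθ]
    exact ((((((hx.fun_sub hy).sub_const _).sub_const _).sub_const _).sub_const _).fun_sub
      (Complex.ofRealCLM.hasDerivAt (x := t)))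
  have dκ : HasDerivAt κ (((n : ℂ) + μ / 2) * 1 + a' + x) t := by
    rw [eκ]
    exact ((((Complex.ofRealCLM.hasDerivAt (x := t)).const_mul _).fun_add ha).fun_add hx)
  have sub := (ho t ht).recA_sq_add_recA_sq hP (n := n) le_rfl
  have eb : recB (p t) n = sublead (p t) n / lead (p t) n
      - sublead (p t) (n + 1) / lead (p t) (n + 1) := rfl
  have hθt := hθ t
  rw [theta] at hθt
  have hκt := hκ t
  rw [kappa_eq_sublead] at hκt
  refine ⟨dθ.differentiableAt, dκ.differentiableAt, ?_, ?_⟩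
  · rw [dθ.deriv, hκt, hθt]
    linear_combination ex - ey - eb - sub
  · intro h1 h2
    rw [dκ.deriv]
    -- For `n ≥ 1` the last factor is `θ_{n-1}`, and this is the determinant identity at `x = 0`;
    -- `e2` is the one at `x = t`. For `n = 0` both sides vanish, as `a_0 = 0` and `κ_0 = μ t / 2`.
    have e1 : recA (p t) n ^ 2 * θ t * (recB (p t) (n - 1) - 2 * n + 1 - α - μ - t)
        = κ t ^ 2 - μ ^ 2 * t ^ 2 / 4 := by
      rcases n with _ | m
      · rw [hκt]
        simp [recA, sublead]
        ring
      · have h := (ho t ht).det_eq_zero hP (m := m) le_rfl (x := 0) (by ring)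
        rw [hθt, hκt, Nat.add_sub_cancel]
        push_cast
        linear_combination h
    have e2 : recA (p t) n ^ 2 * (θ t + t) * (recB (p t) (n - 1) - 2 * n + 1 - α - μ)
        = (κ t - (n + (μ + α) / 2) * t) ^ 2 - α ^ 2 * t ^ 2 / 4 := by
      rcases n with _ | m
      · rw [hκt]
        simp [recA, sublead]
        ring
      · have h := (ho t ht).det_eq_zero hP (m := m) le_rfl (x := t) (by ring)
        rw [hθt, hκt, Nat.add_sub_cancel]
        push_cast
        linear_combination h
    have e3 : t * (((n : ℂ) + μ / 2) * 1 + a' + x) = κ t + recA (p t) n ^ 2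
        * ((recB (p t) (n - 1) - 2 * n + 1 - α - μ - t) - θ t) := by
      rw [hκt, hθt]
      linear_combination ex + ea
    rw [e3]
    generalize recA (p t) n ^ 2 = A at *
    generalize recB (p t) (n - 1) - 2 * n + 1 - α - μ = D at *
    have f1 : A * (D - t) = (κ t ^ 2 - μ ^ 2 * t ^ 2 / 4) / θ t := by
      rw [eq_div_iff h1]
      linear_combination e1
    have f2 : A * D = ((κ t - (n + (μ + α) / 2) * t) ^ 2 - α ^ 2 * t ^ 2 / 4) / (θ t + t) := by
      rw [eq_div_iff h2]
      linear_combination e2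
    -- With `D = θ_{n-1} + t`, the difference of the two identities is `t` times a relation linear
    -- in `κ_n`, which gives `a_n² θ_n`.
    have f3 : A * θ t = t * (n ^ 2 + (n + μ / 2) * (α + μ)) - (2 * n + μ + α) * κ t
        - A * D := by
      refine mul_left_cancel₀ htC ?_
      linear_combination e2 - e1
    linear_combination f1 - f3 + f2
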